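/- Let $G$ be a compact ($n$-dimensional, Hausdorff) Lie group with Lie algebra $\mathfrak g$, let $X_1,\dots,X_n$ be a basis of $\mathfrak g$, identified with left-invariant vector fields, and let $m$ be the normalised (right-invariant) Haar measure. Let the following characteristics be given (summation convention in force): * bounded measurable functions $b^i, a^{jk}:G\to\mathbb R$ such that $(a^{jk}(g))$ is symmetric and non-negative definite for each $g\in G$; * an open neighbourhood $U$ of the identity $e$ with compact closure and functions $x^i=x_i\in C_c^\infty(G)$ that are canonical coordinates on $U$, i.e. $c\mapsto \exp(c^iX_i)$ is a bijection of an open neighbourhood of $0\in\mathbb R^n$ onto $U$ with inverse $(x^1,\dots,x^n)$; * a Lévy kernel $\nu$: each $\nu(g,\cdot)$ is a Borel measure on $G$ with $\nu(g,\{g\})=0$, $g\mapsto\nu(g,gB)$ is measurable for each Borel set $B$, and $$\sup_{g}\int_G\Big(\sum_i x_i(\tau)^2\wedge 1\Big)\,\nu(g,g\,d\tau)<\infty,\qquad \sup_g\nu(g,gU^c)<\infty;$$ * a Lévy measure $\rho$ on $G$ (that is, $\rho(\{e\})=0$, $\int_G(\sum_i x_i^2\wedge1)\,d\rho<\infty$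 and $\rho(U^c)<\infty$) such that $\nu(g,g\,\cdot)\ll\rho$ for all $g$, with density $\lambda(g,\cdot)$, where $\sup_{\tau\in U^c}\sup_g\lambda(g,\tau)<\infty$ and there is $g'\in G$ with $\lambda(g',\tau)=\sup_g\lambda(g,\tau)$ for all $\tau\in U$. Let $\mathcal H_2(G)$ be the space of those $f\in L^2(G,\mathbb C)$ whose weak derivatives $X_if$ and $X_jX_kf$ lie in $L^2(G,\mathbb C)$. The Courrège–Hunt operator $\mathcal L$ is the operator in $L^2(G,\mathbb C)$ given by $$\mathcal Lf(g)=b^i(g)X_if(g)+a^{ij}(g)X_iX_jf(g)+\int_G\big[f(\tau)-f(g)-x^i(g^{-1}\tau)X_if(g)\big]\,\nu(g,d\tau)$$ for almost every $g$, for those $f\in\mathcal H_2(G)$ for which the integral converges absolutely for almost every $g$ and the result lies in $L^2(G,\mathbb C)$. Then $\mathcal L$ is a well-defined linear operator, its domain is all of $\mathcal H_2(G)$, and $\mathcal L$ is a pseudo differential operator with symbol $$j(g,\pi)=b^i(g)\,d\pi(X_i)+a^{ij}(g)\,d\pi(X_i)\,d\pi(X_j)+\int_G\big[\pi(g^{-1}\tau)-I-x^i(g^{-1}\tau)\,d\pi(X_i)\big]\,\nu(g,d\tau),$$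 where $d\pi(X)=\frac{d}{du}\pi(\exp(uX))|_{u=0}$. That is: the linear span of the matrix coefficients $g\mapsto\langle\pi(g)\psi,\phi\rangle$ of all irreducible unitary representations $\pi$ of $G$ is contained in the domain of $\mathcal L$; for every such $\pi$ the integral in $j(g,\pi)$ converges absolutely for every $g$; the matrix entries of $g\mapsto j(g,\pi)$ are measurable; and $j(g,\pi)=\pi(g^{-1})\mathcal L\pi(g)$, i.e. $$j(g,\pi)_{ij}=\sum_k\overline{\pi_{ki}(g)}\,(\mathcal L\pi_{kj})(g),$$ both for almost every $g$ with $\mathcal L\pi_{kj}$ understood in $L^2(G,\mathbb C)$, and for every $g$ with $\mathcal L\pi_{kj}(g)$ given by the (absolutely convergent) pointwise formula for the smooth function $\pi_{kj}$. -/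

import Mathlib

open MeasureTheory Set Filter Topology
open scoped Manifold ContDiff ENNReal NNReal Matrix

noncomputable section

set_option linter.unusedSectionVars false

namespace CourregeHunt

/-! ### Lie group preliminaries -/

section LieGroupNotions

variable {E : Type*} [NormedAddCommGroup E] [NormedSpace ℝ E]
  {G : Type*} [TopologicalSpace G] [ChartedSpace E G] [Group G]

/-- The derivative `X f` of `f : G → F` along the left-invariant vector field whose value at the
identity is `X`. -/
def leftDeriv {F : Type*} [NormedAddCommGroup F] [NormedSpace ℝ F]
    (X : GroupLieAlgebra 𝓘(ℝ, E) G) (f : G → F) (g : G) : F :=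
  mfderiv 𝓘(ℝ, E) 𝓘(ℝ, F) f g (mulInvariantVectorField X g)

open Classical in
/-- The exponential map of a Lie group: the value at time `1` of the integral curve, starting
at the identity, of the left-invariant vector field generated by `X`. (On a Lie group this
integral curve exists for all times and is unique.) -/
def lieExp (X : GroupLieAlgebra 𝓘(ℝ, E) G) : G :=
  if h : ∃ γ : ℝ → G, γ 0 = 1 ∧
      IsMIntegralCurve (I := 𝓘(ℝ, E)) γ (mulInvariantVectorField X) then h.choose 1
  else 1

/-- `x₁, …, xₙ` are canonical coordinates (of the first kind, for the basis `X₁, …, Xₙ`) on the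
open neighbourhood `U` of the identity: `c ↦ exp (∑ cᵢ Xᵢ)` is a bijection from an open
neighbourhood of `0` in `ℝⁿ` onto `U`, with inverse `x`. -/
def IsCanonicalCoord {n : ℕ} (X : Fin n → GroupLieAlgebra 𝓘(ℝ, E) G) (U : Set G)
    (x : Fin n → G → ℝ) : Prop :=
  IsOpen U ∧ (1 : G) ∈ U ∧ ∃ V : Set (Fin n → ℝ), IsOpen V ∧ (0 : Fin n → ℝ) ∈ V ∧
    MapsTo (fun c : Fin n → ℝ => (lieExp (∑ i, c i • X i) : G)) V U ∧
    MapsTo (fun τ i => x i τ) U V ∧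
    (∀ c ∈ V, ∀ i, x i (lieExp (∑ j, c j • X j)) = c i) ∧
    (∀ τ ∈ U, lieExp (∑ j, x j τ • X j) = τ)

end LieGroupNotions

/-! ### Unitary representations and pseudo differential operators -/

/-- A continuous irreducible unitary matrix representation of `G`, that is, a finite-dimensional
irreducible unitary representation with a fixed orthonormal basis. -/
structure UnitaryIrrep (G : Type*) [Group G] [TopologicalSpace G] where
  dim : ℕ
  toHom : G →* Matrix.unitaryGroup (Fin dim) ℂ
  continuous_toHom : Continuous toHom
  irreducible : Representation.IsIrreducible
    (((Matrix.toLinAlgEquiv' : Matrix (Fin dim) (Fin dim) ℂ ≃ₐ[ℂ]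
        ((Fin dim → ℂ) →ₗ[ℂ] (Fin dim → ℂ))) : _ →* _).comp
      ((Matrix.unitaryGroup (Fin dim) ℂ).subtype.comp toHom) :
        Representation ℂ G (Fin dim → ℂ))

section PDO

variable {G : Type*} [Group G] [TopologicalSpace G]

/-- The unitary matrix `π(g)`. -/
def UnitaryIrrep.mat (π : UnitaryIrrep G) (g : G) : Matrix (Fin π.dim) (Fin π.dim) ℂ :=
  (π.toHom g : Matrix (Fin π.dim) (Fin π.dim) ℂ)

theorem UnitaryIrrep.continuous_mat (π : UnitaryIrrep G) : Continuous π.mat :=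
  continuous_subtype_val.comp π.continuous_toHom

/-- The matrix coefficient `h_π(ψ, φ) : g ↦ ⟨π(g) ψ, φ⟩` (inner product linear in the first
variable). -/
def UnitaryIrrep.coeff (π : UnitaryIrrep G) (ψ φ : Fin π.dim → ℂ) : C(G, ℂ) where
  toFun g := (π.mat g *ᵥ ψ) ⬝ᵥ star φ
  continuous_toFun := (π.continuous_mat.matrix_mulVec continuous_const).dotProduct continuous_const

/-- The matrix entry `π_{ij} : g ↦ π(g)_{ij}`. -/
def UnitaryIrrep.entry (π : UnitaryIrrep G) (i j : Fin π.dim) : C(G, ℂ) :=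
  π.coeff (Pi.single j 1) (Pi.single i 1)

theorem UnitaryIrrep.entry_apply (π : UnitaryIrrep G) (i j : Fin π.dim) (g : G) :
    π.entry i j g = π.mat g i j := by
  have h : (star (Pi.single i (1 : ℂ)) : Fin π.dim → ℂ) = Pi.single i 1 := by
    rw [← Pi.single_star, star_one]
  change (π.mat g *ᵥ Pi.single j 1) ⬝ᵥ star (Pi.single i (1 : ℂ)) = _
  rw [h]
  simp

variable [CompactSpace G] [MeasurableSpace G] [BorelSpace G]

/-- The class in `L²(G, ℂ)` of a continuous function on the compact group `G`. -/
abbrev toL2 (m : Measure G) [IsFiniteMeasure m] (f : C(G, ℂ)) : Lp ℂ 2 m :=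
  ContinuousMap.toLp 2 m ℂ f

/-- The space `ℳ ⊆ L²(G, ℂ)`: the linear span of all matrix coefficients of continuous
irreducible unitary representations. -/
def matrixCoeffSpan (m : Measure G) [IsFiniteMeasure m] : Submodule ℂ (Lp ℂ 2 m) :=
  Submodule.span ℂ {f | ∃ (π : UnitaryIrrep G) (ψ φ : Fin π.dim → ℂ), f = toL2 m (π.coeff ψ φ)}

theorem entry_mem_matrixCoeffSpan (m : Measure G) [IsFiniteMeasure m]
    (π : UnitaryIrrep G) (i j : Fin π.dim) : toL2 m (π.entry i j) ∈ matrixCoeffSpan m :=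
  Submodule.subset_span ⟨π, Pi.single j 1, Pi.single i 1, rfl⟩

/-- The linear operator `A` in `L²(G, ℂ)` is a pseudo differential operator with symbol `σ`. The
identity `σ(g, π) = π(g⁻¹) A π(g)` is written out in matrix entries; as `A π_{kj}` is an element
of `L²(G, ℂ)`, it is an identity for almost every `g`. -/
structure IsPseudoDiffOpWithSymbol (m : Measure G) [IsFiniteMeasure m]
    (A : Lp ℂ 2 m →ₗ.[ℂ] Lp ℂ 2 m)
    (σ : G → (π : UnitaryIrrep G) → Matrix (Fin π.dim) (Fin π.dim) ℂ) : Prop where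
  span_le_domain : matrixCoeffSpan m ≤ A.domain
  symbol_eq : ∀ (π : UnitaryIrrep G) (i j : Fin π.dim), ∀ᵐ g ∂m,
    σ g π i j = ∑ k, star (π.mat g k i) *
      (A ⟨toL2 m (π.entry k j), span_le_domain (entry_mem_matrixCoeffSpan m π k j)⟩ : Lp ℂ 2 m) g
  measurable_symbol : ∀ (π : UnitaryIrrep G) (i j : Fin π.dim), Measurable fun g => σ g π i j

end PDO

/-- The derived representation `dπ(X) = d/du π(exp(uX))` at `u = 0`. -/
def UnitaryIrrep.deriv {E : Type*} [NormedAddCommGroup E] [NormedSpace ℝ E]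
    {G : Type*} [TopologicalSpace G] [ChartedSpace E G] [Group G]
    (π : UnitaryIrrep G) (X : GroupLieAlgebra 𝓘(ℝ, E) G) :
    Matrix (Fin π.dim) (Fin π.dim) ℂ :=
  Matrix.of fun i j => _root_.deriv (fun u : ℝ => π.mat (lieExp (u • X)) i j) 0

/-! ### The Sobolev space of order two -/

section Sobolev

variable {E : Type*} [NormedAddCommGroup E] [NormedSpace ℝ E]
  {G : Type*} [TopologicalSpace G] [ChartedSpace E G] [Group G] [MeasurableSpace G]

/-- `h` is the weak (distributional) derivative of `f` along the left-invariant vector field `X`,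
with respect to the (right-invariant) measure `m`; the group being compact, test functions are
all the smooth functions. -/
def IsWeakLeftDeriv (m : Measure G) (X : GroupLieAlgebra 𝓘(ℝ, E) G) (f h : G → ℂ) : Prop :=
  ∀ φ : G → ℝ, ContMDiff 𝓘(ℝ, E) 𝓘(ℝ, ℝ) ∞ φ →
    ∫ g, leftDeriv X φ g • f g ∂m = -∫ g, φ g • h g ∂m

/-- `f ∈ L²`, with weak derivatives `Xᵢ f = D i ∈ L²` and `Xᵢ Xⱼ f = D₂ i j ∈ L²`. -/
structure IsSobolevTwo {n : ℕ} (m : Measure G) (X : Fin n → GroupLieAlgebra 𝓘(ℝ, E) G)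
    (f : G → ℂ) (D : Fin n → G → ℂ) (D₂ : Fin n → Fin n → G → ℂ) : Prop where
  memLp : MemLp f 2 m
  memLp_first : ∀ i, MemLp (D i) 2 m
  memLp_second : ∀ i j, MemLp (D₂ i j) 2 m
  first : ∀ i, IsWeakLeftDeriv m (X i) f (D i)
  second : ∀ i j, IsWeakLeftDeriv m (X i) (D j) (D₂ i j)

variable [LieGroup 𝓘(ℝ, E) ∞ G] [FiniteDimensional ℝ E]

theorem continuous_leftDeriv (X : GroupLieAlgebra 𝓘(ℝ, E) G) {φ : G → ℝ}
    (hφ : ContMDiff 𝓘(ℝ, E) 𝓘(ℝ, ℝ) ∞ φ) : Continuous (leftDeriv X φ) := by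
  have h3 : minSmoothness ℝ 3 ≤ (∞ : WithTop ℕ∞) := by
    simp only [minSmoothness_of_isRCLikeNormedField]
    change ((3 : ℕ∞) : WithTop ℕ∞) ≤ ((⊤ : ℕ∞) : WithTop ℕ∞)
    exact_mod_cast (le_top : (3 : ℕ∞) ≤ ⊤)
  have : CompleteSpace E := FiniteDimensional.complete ℝ E
  have : LieGroup 𝓘(ℝ, E) (minSmoothness ℝ 3) G := LieGroup.of_le h3
  have h1 := (contMDiff_mulInvariantVectorField (I := 𝓘(ℝ, E)) (G := G) X).continuous
  have h2 : Continuous (tangentMap 𝓘(ℝ, E) 𝓘(ℝ, ℝ) φ) :=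
    hφ.continuous_tangentMap (by simp)
  exact (contMDiff_snd_tangentBundle_modelSpace ℝ 𝓘(ℝ, ℝ) (n := 1)).continuous.comp (h2.comp h1)

variable [CompactSpace G] [BorelSpace G] {m : Measure G} [IsFiniteMeasure m]

theorem integrable_smul_of_memLp {φ : G → ℝ} (hφ : Continuous φ) {f : G → ℂ}
    (hf : MemLp f 2 m) : Integrable (fun g => φ g • f g) m := by
  obtain ⟨C, hC⟩ := isCompact_univ.exists_bound_of_continuousOn hφ.continuousOn
  exact (hf.integrable one_le_two).bdd_smul C hφ.aestronglyMeasurable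
    (Eventually.of_forall fun g => hC g (mem_univ g))

theorem IsWeakLeftDeriv.add {X : GroupLieAlgebra 𝓘(ℝ, E) G} {f f' h h' : G → ℂ}
    (hf : MemLp f 2 m) (hf' : MemLp f' 2 m) (hh : MemLp h 2 m) (hh' : MemLp h' 2 m)
    (H : IsWeakLeftDeriv m X f h) (H' : IsWeakLeftDeriv m X f' h') :
    IsWeakLeftDeriv m X (f + f') (h + h') := by
  intro φ hφ
  have c1 := continuous_leftDeriv X hφ
  have c2 := hφ.continuous
  simp only [Pi.add_apply, smul_add]
  rw [integral_add (integrable_smul_of_memLp c1 hf) (integrable_smul_of_memLp c1 hf'),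
    integral_add (integrable_smul_of_memLp c2 hh) (integrable_smul_of_memLp c2 hh'),
    H φ hφ, H' φ hφ]
  ring

theorem IsWeakLeftDeriv.const_smul {X : GroupLieAlgebra 𝓘(ℝ, E) G} {f h : G → ℂ} (c : ℂ)
    (H : IsWeakLeftDeriv m X f h) : IsWeakLeftDeriv m X (c • f) (c • h) := by
  intro φ hφ
  simp only [Pi.smul_apply, smul_comm _ c]
  rw [integral_smul, integral_smul, H φ hφ, smul_neg]

theorem IsSobolevTwo.add {n : ℕ} {X : Fin n → GroupLieAlgebra 𝓘(ℝ, E) G} {f f' : G → ℂ}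
    {D D' : Fin n → G → ℂ} {D₂ D₂' : Fin n → Fin n → G → ℂ}
    (H : IsSobolevTwo m X f D D₂) (H' : IsSobolevTwo m X f' D' D₂') :
    IsSobolevTwo m X (f + f') (D + D') (D₂ + D₂') where
  memLp := H.memLp.add H'.memLp
  memLp_first i := (H.memLp_first i).add (H'.memLp_first i)
  memLp_second i j := (H.memLp_second i j).add (H'.memLp_second i j)
  first i := (H.first i).add H.memLp H'.memLp (H.memLp_first i) (H'.memLp_first i) (H'.first i)
  second i j := (H.second i j).add (H.memLp_first j) (H'.memLp_first j) (H.memLp_second i j)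
    (H'.memLp_second i j) (H'.second i j)

theorem IsSobolevTwo.const_smul {n : ℕ} {X : Fin n → GroupLieAlgebra 𝓘(ℝ, E) G} {f : G → ℂ}
    {D : Fin n → G → ℂ} {D₂ : Fin n → Fin n → G → ℂ} (c : ℂ)
    (H : IsSobolevTwo m X f D D₂) : IsSobolevTwo m X (c • f) (c • D) (c • D₂) where
  memLp := H.memLp.const_smul c
  memLp_first i := (H.memLp_first i).const_smul c
  memLp_second i j := (H.memLp_second i j).const_smul c
  first i := (H.first i).const_smul c
  second i j := (H.second i j).const_smul c

theorem IsSobolevTwo.zero {n : ℕ} {X : Fin n → GroupLieAlgebra 𝓘(ℝ, E) G} :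
    IsSobolevTwo m X (0 : G → ℂ) 0 0 where
  memLp := MemLp.zero
  memLp_first _ := MemLp.zero
  memLp_second _ _ := MemLp.zero
  first _ := fun φ _ => by simp
  second _ _ := fun φ _ => by simp

theorem IsWeakLeftDeriv.congr {X : GroupLieAlgebra 𝓘(ℝ, E) G} {f f' h : G → ℂ}
    (hff' : f =ᵐ[m] f') (H : IsWeakLeftDeriv m X f h) : IsWeakLeftDeriv m X f' h := by
  intro φ hφ
  rw [← H φ hφ]
  refine integral_congr_ae ?_
  filter_upwards [hff'] with g hg
  rw [hg]

theorem IsSobolevTwo.congr {n : ℕ} {X : Fin n → GroupLieAlgebra 𝓘(ℝ, E) G} {f f' : G → ℂ}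
    {D : Fin n → G → ℂ} {D₂ : Fin n → Fin n → G → ℂ} (hff' : f =ᵐ[m] f')
    (H : IsSobolevTwo m X f D D₂) : IsSobolevTwo m X f' D D₂ where
  memLp := (memLp_congr_ae hff').1 H.memLp
  memLp_first := H.memLp_first
  memLp_second := H.memLp_second
  first i := (H.first i).congr hff'
  second := H.second

/-- The Sobolev space `ℋ₂(G)` as a subspace of `L²(G, ℂ)`. -/
def sobolevTwo {n : ℕ} (m : Measure G) [IsFiniteMeasure m]
    (X : Fin n → GroupLieAlgebra 𝓘(ℝ, E) G) : Submodule ℂ (Lp ℂ 2 m) where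
  carrier := {f | ∃ D D₂, IsSobolevTwo m X f D D₂}
  zero_mem' := ⟨0, 0, IsSobolevTwo.zero.congr (Lp.coeFn_zero ℂ 2 m).symm⟩
  add_mem' := by
    rintro f f' ⟨D, D₂, H⟩ ⟨D', D₂', H'⟩
    exact ⟨D + D', D₂ + D₂', (H.add H').congr (Lp.coeFn_add f f').symm⟩
  smul_mem' := by
    rintro c f ⟨D, D₂, H⟩
    exact ⟨c • D, c • D₂, (H.const_smul c).congr (Lp.coeFn_smul c f).symm⟩

end Sobolev

/-! ### Courrège–Hunt operators -/

/-- The image of the measure `ν(g, ·)` under `τ ↦ g⁻¹ τ`, that is, `E ↦ ν(g, gE)`. -/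
def shifted {G : Type*} [Group G] [MeasurableSpace G] (ν : G → Measure G) (g : G) : Measure G :=
  (ν g).map fun τ => g⁻¹ * τ

/-- The characteristics of a Courrège–Hunt operator on an `n`-dimensional Lie group `G`. -/
structure Characteristics (E : Type*) [NormedAddCommGroup E] [NormedSpace ℝ E]
    (G : Type*) [TopologicalSpace G] [ChartedSpace E G] [Group G] [MeasurableSpace G]
    (n : ℕ) where
  /-- the basis `X₁, …, Xₙ` of the Lie algebra -/
  X : Module.Basis (Fin n) ℝ (GroupLieAlgebra 𝓘(ℝ, E) G)
  /-- the drift -/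
  b : Fin n → G → ℝ
  measurable_b : ∀ i, Measurable (b i)
  bounded_b : ∃ C, ∀ i g, |b i g| ≤ C
  /-- the diffusion matrix -/
  a : G → Matrix (Fin n) (Fin n) ℝ
  measurable_a : ∀ i j, Measurable fun g => a g i j
  bounded_a : ∃ C, ∀ i j g, |a g i j| ≤ C
  posSemidef_a : ∀ g, (a g).PosSemidef
  /-- the coordinate neighbourhood of the identity -/
  U : Set G
  isCompact_closure_U : IsCompact (closure U)
  /-- the coordinate functions -/
  x : Fin n → G → ℝ
  contMDiff_x : ∀ i, ContMDiff 𝓘(ℝ, E) 𝓘(ℝ, ℝ) ∞ (x i)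
  hasCompactSupport_x : ∀ i, HasCompactSupport (x i)
  isCanonicalCoord : IsCanonicalCoord X U x
  /-- the Lévy kernel -/
  ν : G → Measure G
  ν_self : ∀ g, ν g {g} = 0
  measurable_ν : ∀ B, MeasurableSet B → Measurable fun g => shifted ν g B
  levy_ν : ∃ C : ℝ≥0, ∀ g,
    ∫⁻ τ, ENNReal.ofReal (min (∑ i, x i τ ^ 2) 1) ∂(shifted ν g) ≤ C
  levy_ν_compl : ∃ C : ℝ≥0, ∀ g, shifted ν g Uᶜ ≤ C
  /-- the dominating Lévy measure -/
  ρ : Measure G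
  ρ_one : ρ {1} = 0
  levy_ρ : ∫⁻ τ, ENNReal.ofReal (min (∑ i, x i τ ^ 2) 1) ∂ρ < ⊤
  levy_ρ_compl : ρ Uᶜ < ⊤
  /-- the Radon–Nikodým derivatives `lam g = dν(g, g·)/dρ` -/
  lam : G → G → ℝ≥0∞
  measurable_lam : ∀ g, Measurable (lam g)
  shifted_ν_eq : ∀ g, shifted ν g = ρ.withDensity (lam g)
  lam_bounded : ∃ C : ℝ≥0, ∀ τ ∈ Uᶜ, ∀ g, lam g τ ≤ C
  lam_attained : ∃ g', ∀ τ ∈ U, lam g' τ = ⨆ g, lam g τ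

namespace Characteristics

variable {E : Type*} [NormedAddCommGroup E] [NormedSpace ℝ E]
  {G : Type*} [TopologicalSpace G] [ChartedSpace E G] [Group G] [MeasurableSpace G]
  {n : ℕ} (χ : Characteristics E G n)

/-- The integrand `f(τ) - f(g) - xⁱ(g⁻¹τ) Xᵢf(g)`, where `D i` stands for `Xᵢ f`. -/
def jump (f : G → ℂ) (D : Fin n → G → ℂ) (g τ : G) : ℂ :=
  f τ - f g - ∑ i, (χ.x i (g⁻¹ * τ) : ℂ) * D i g

/-- The expression
`bⁱ(g) Xᵢf(g) + aⁱʲ(g) XᵢXⱼf(g) + ∫ [f(τ) - f(g) - xⁱ(g⁻¹τ) Xᵢf(g)] ν(g, dτ)`,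
where `D i` stands for `Xᵢ f` and `D₂ i j` for `Xᵢ Xⱼ f`. -/
def expr (f : G → ℂ) (D : Fin n → G → ℂ) (D₂ : Fin n → Fin n → G → ℂ) (g : G) : ℂ :=
  ∑ i, (χ.b i g : ℂ) * D i g + ∑ i, ∑ j, (χ.a g i j : ℂ) * D₂ i j g
    + ∫ τ, χ.jump f D g τ ∂(χ.ν g)

/-- The same expression for a smooth function `f`, with classical derivatives. -/
def classical (f : G → ℂ) (g : G) : ℂ :=
  χ.expr f (fun i => leftDeriv (χ.X i) f)
    (fun i j => leftDeriv (χ.X i) (leftDeriv (χ.X j) f)) g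

theorem jump_add (f f' : G → ℂ) (D D' : Fin n → G → ℂ) (g : G) :
    χ.jump (f + f') (D + D') g = χ.jump f D g + χ.jump f' D' g := by
  funext τ
  simp only [jump, Pi.add_apply, mul_add, Finset.sum_add_distrib]
  ring

theorem jump_smul (c : ℂ) (f : G → ℂ) (D : Fin n → G → ℂ) (g : G) :
    χ.jump (c • f) (c • D) g = c • χ.jump f D g := by
  funext τ
  simp only [jump, Pi.smul_apply, smul_eq_mul, mul_sub, Finset.mul_sum]
  congr 1
  refine Finset.sum_congr rfl fun i _ => ?_
  ring

theorem expr_add {f f' : G → ℂ} {D D' : Fin n → G → ℂ} {D₂ D₂' : Fin n → Fin n → G → ℂ} {g : G}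
    (h : Integrable (χ.jump f D g) (χ.ν g)) (h' : Integrable (χ.jump f' D' g) (χ.ν g)) :
    χ.expr (f + f') (D + D') (D₂ + D₂') g = χ.expr f D D₂ g + χ.expr f' D' D₂' g := by
  simp only [expr, jump_add, Pi.add_apply, mul_add, Finset.sum_add_distrib]
  rw [integral_add h h']
  ring

theorem expr_smul (c : ℂ) (f : G → ℂ) (D : Fin n → G → ℂ) (D₂ : Fin n → Fin n → G → ℂ) (g : G) :
    χ.expr (c • f) (c • D) (c • D₂) g = c • χ.expr f D D₂ g := by
  have hI : ∫ τ, χ.jump (c • f) (c • D) g τ ∂(χ.ν g) = c * ∫ τ, χ.jump f D g τ ∂(χ.ν g) := by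
    rw [jump_smul]
    exact integral_smul c _
  simp only [expr, hI, Pi.smul_apply, smul_eq_mul, mul_add, Finset.mul_sum]
  congr 2
  · refine Finset.sum_congr rfl fun i _ => ?_
    ring
  · refine Finset.sum_congr rfl fun i _ => Finset.sum_congr rfl fun j _ => ?_
    ring

/-- The matrix-valued integrand `π(g⁻¹τ) - I - xⁱ(g⁻¹τ) dπ(Xᵢ)` of the symbol. -/
def symbolJump (π : UnitaryIrrep G) (g τ : G) : Matrix (Fin π.dim) (Fin π.dim) ℂ :=
  π.mat (g⁻¹ * τ) - 1 - ∑ i, (χ.x i (g⁻¹ * τ) : ℂ) • π.deriv (χ.X i)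

/-- The symbol
`bⁱ(g) dπ(Xᵢ) + aⁱʲ(g) dπ(Xᵢ) dπ(Xⱼ) + ∫ [π(g⁻¹τ) - I - xⁱ(g⁻¹τ) dπ(Xᵢ)] ν(g, dτ)`;
the integral is taken entry by entry. -/
def symbol (g : G) (π : UnitaryIrrep G) : Matrix (Fin π.dim) (Fin π.dim) ℂ :=
  ∑ i, (χ.b i g : ℂ) • π.deriv (χ.X i)
    + ∑ i, ∑ j, (χ.a g i j : ℂ) • (π.deriv (χ.X i) * π.deriv (χ.X j))
    + Matrix.of fun k l => ∫ τ, χ.symbolJump π g τ k l ∂(χ.ν g)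

variable [LieGroup 𝓘(ℝ, E) ∞ G] [FiniteDimensional ℝ E] [CompactSpace G] [BorelSpace G]

/-- The graph of the Courrège–Hunt operator in `L²(G, ℂ)`: the pairs `(f, u)` such that
`f ∈ ℋ₂(G)` and, for almost every `g`, the integral in the Courrège–Hunt formula for `f`
converges absolutely and the formula takes the value `u(g)`. -/
def graph (m : Measure G) [IsFiniteMeasure m] : Submodule ℂ (Lp ℂ 2 m × Lp ℂ 2 m) where
  carrier := {p | ∃ (F : G → ℂ) (D : Fin n → G → ℂ) (D₂ : Fin n → Fin n → G → ℂ),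
    F =ᵐ[m] p.1 ∧ IsSobolevTwo m χ.X F D D₂ ∧
    (∀ᵐ g ∂m, Integrable (χ.jump F D g) (χ.ν g)) ∧ p.2 =ᵐ[m] χ.expr F D D₂}
  zero_mem' := by
    refine ⟨0, 0, 0, (Lp.coeFn_zero ℂ 2 m).symm, IsSobolevTwo.zero, ?_, ?_⟩
    · refine Eventually.of_forall fun g => ?_
      have : χ.jump 0 0 g = 0 := by funext τ; simp [jump]
      rw [this]
      exact integrable_zero _ _ _
    · filter_upwards [Lp.coeFn_zero ℂ 2 m] with g hg
      have : χ.jump 0 0 g = 0 := by funext τ; simp [jump]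
      have h0 : χ.expr 0 0 0 g = 0 := by simp [expr, this]
      rw [h0]
      exact hg
  add_mem' := by
    rintro ⟨f, u⟩ ⟨f', u'⟩ ⟨F, D, D₂, hF, hS, hI, hu⟩ ⟨F', D', D₂', hF', hS', hI', hu'⟩
    refine ⟨F + F', D + D', D₂ + D₂', (hF.add hF').trans (Lp.coeFn_add f f').symm,
      hS.add hS', ?_, ?_⟩
    · filter_upwards [hI, hI'] with g h h'
      rw [jump_add]
      exact h.add h'
    · filter_upwards [hI, hI', hu, hu', Lp.coeFn_add u u'] with g h h' hg hg' ha
      rw [expr_add χ h h', ← hg, ← hg']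
      exact ha
  smul_mem' := by
    rintro c ⟨f, u⟩ ⟨F, D, D₂, hF, hS, hI, hu⟩
    refine ⟨c • F, c • D, c • D₂, (hF.const_smul c).trans (Lp.coeFn_smul c f).symm,
      hS.const_smul c, ?_, ?_⟩
    · filter_upwards [hI] with g h
      rw [jump_smul]
      exact h.smul c
    · filter_upwards [hu, Lp.coeFn_smul c u] with g hg ha
      rw [expr_smul, ← hg]
      exact ha

/-- The Courrège–Hunt operator, as a linear operator in `L²(G, ℂ)`. -/
def operator (m : Measure G) [IsFiniteMeasure m] : Lp ℂ 2 m →ₗ.[ℂ] Lp ℂ 2 m :=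
  (χ.graph m).toLinearPMap

end Characteristics

end CourregeHunt

end

noncomputable section

set_option linter.unusedSectionVars false

namespace CourregeHunt

/-! ### One-parameter subgroups -/

section Flow

variable {E : Type*} [NormedAddCommGroup E] [NormedSpace ℝ E] [FiniteDimensional ℝ E]
  {G : Type*} [TopologicalSpace G] [ChartedSpace E G] [Group G] [LieGroup 𝓘(ℝ, E) ∞ G]
  [T2Space G]

/-! The analytic core is that the jump integral of an element of `ℋ₂(G)` lies in `L²`. After the
shift `τ ↦ gτ` its integrand is `F(gτ) - F(g) - xⁱ(τ) Dᵢ(g)`. For `τ = exp(∑ cᵢXᵢ)` this is a first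
order Taylor remainder along right translations, with `L²` norm in `g` of order `∑ cᵢ²`
(`IsSobolevTwo.eLpNorm_taylor_le`). No approximation of `F` by smooth functions is needed. Paired
with a test function, the remainder becomes a Taylor remainder of a scalar function of `t`: right
invariance moves the translation onto the test function, and the weak derivatives compute the scalar
function's two derivatives. Density of smooth functions in `L²` then recovers the norm.

Off `U` the trivial bound suffices. So the `L²` norm in `g` is at most a multiple of `weight τ`,
which is integrable for every Lévy measure. The hypotheses on the densities yield one measure
dominating all shifted kernels (`exists_dominating`), and a weighted Minkowski inequality integrates
the bound (`lintegral_sq_lintegral_le`). Hence the formula makes sense on all of `ℋ₂(G)`. It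
respects almost everywhere equality: weak derivatives are unique, and Fubini with the dominating
measure shows that an `m`-null set is `ν(g, ·)`-null for almost every `g` (`ae_ae_eq_zero`). So the
graph is that of a linear operator with domain `ℋ₂(G)`.

For the symbol, a continuous matrix representation `P` is shown to be differentiable by smoothing:
`∫ φ(h) P(h)` is invertible for a bump `φ` near the identity, so `P(k)` can be expressed through `∫
φ(hk⁻¹) P(h)`, where `k` enters only through `φ` (`exists_hasDerivAt_hom`). Then `P ∘ exp` is a
matrix exponential, which gives differentiability on the manifold and a Taylor bound for absolute
convergence. Finally `π(τ) = π(g) π(g⁻¹τ)` and `Xπ = π dπ(X)` let `π(g)` factor out of the whole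
formula (`classical_entry`), and unitarity cancels it. -/

theorem contMDiff_leftInvariant (X : GroupLieAlgebra 𝓘(ℝ, E) G) :
    ContMDiff 𝓘(ℝ, E) 𝓘(ℝ, E).tangent 1
      (fun g : G => (⟨g, mulInvariantVectorField X g⟩ : TangentBundle 𝓘(ℝ, E) G)) := by
  have h3 : minSmoothness ℝ 3 ≤ (∞ : WithTop ℕ∞) := by
    simp only [minSmoothness_of_isRCLikeNormedField]
    change ((3 : ℕ∞) : WithTop ℕ∞) ≤ ((⊤ : ℕ∞) : WithTop ℕ∞)
    exact_mod_cast (le_top : (3 : ℕ∞) ≤ ⊤)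
  have : CompleteSpace E := FiniteDimensional.complete ℝ E
  have : LieGroup 𝓘(ℝ, E) (minSmoothness ℝ 3) G := LieGroup.of_le h3
  refine (contMDiff_mulInvariantVectorField (I := 𝓘(ℝ, E)) (G := G) X).of_le ?_
  simp

theorem contMDiff_mul_left' (g : G) :
    ContMDiff 𝓘(ℝ, E) 𝓘(ℝ, E) ∞ (fun h : G => g * h) :=
  contMDiff_mul_left (I := 𝓘(ℝ, E)) (n := ∞)

theorem contMDiff_mul_right' (g : G) :
    ContMDiff 𝓘(ℝ, E) 𝓘(ℝ, E) ∞ (fun h : G => h * g) :=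
  contMDiff_mul_right (I := 𝓘(ℝ, E)) (n := ∞)

/-- The chain rule at the identity for left translation by `g * h`, seen as a composition of two
left translations. -/
theorem mfderiv_mul_left_leftInvariant (X : GroupLieAlgebra 𝓘(ℝ, E) G) (g h : G) :
    mfderiv 𝓘(ℝ, E) 𝓘(ℝ, E) (fun k : G => g * k) h (mulInvariantVectorField X h)
      = mulInvariantVectorField X (g * h) := by
  have hd : ∀ a b : G, MDifferentiableAt 𝓘(ℝ, E) 𝓘(ℝ, E) (fun k : G => a * k) b := fun a b =>
    (contMDiff_mul_left' a).contMDiffAt.mdifferentiableAt (by simp)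
  have hc : (fun k : G => g * h * k) = (fun k => g * k) ∘ fun k => h * k := by
    funext k
    simp [mul_assoc]
  -- Tangent spaces at `h * 1` and `h` are different types syntactically; viewing all differentials
  -- as maps `E → E` permits rewriting the base point.
  let D : G → E →L[ℝ] E := fun p => mfderiv 𝓘(ℝ, E) 𝓘(ℝ, E) (fun k : G => g * k) p
  have h1 : (mfderiv 𝓘(ℝ, E) 𝓘(ℝ, E) (fun k : G => g * h * k) 1 : E →L[ℝ] E)
      = (mfderiv 𝓘(ℝ, E) 𝓘(ℝ, E) (fun k : G => g * k) (h * 1) : E →L[ℝ] E).comp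
        (mfderiv 𝓘(ℝ, E) 𝓘(ℝ, E) (fun k : G => h * k) 1 : E →L[ℝ] E) := by
    rw [hc]
    exact mfderiv_comp (I' := 𝓘(ℝ, E)) (1 : G) (hd _ _) (hd _ _)
  have h2 : (mfderiv 𝓘(ℝ, E) 𝓘(ℝ, E) (fun k : G => g * k) (h * 1) : E →L[ℝ] E)
      = (mfderiv 𝓘(ℝ, E) 𝓘(ℝ, E) (fun k : G => g * k) h : E →L[ℝ] E) :=
    congrArg D (mul_one h)
  rw [h2] at h1
  exact (congrArg (fun L : E →L[ℝ] E => L X) h1).symm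

theorem IsMIntegralCurveOn.mul_left {X : GroupLieAlgebra 𝓘(ℝ, E) G} {γ : ℝ → G} {s : Set ℝ}
    (hγ : IsMIntegralCurveOn (I := 𝓘(ℝ, E)) γ (mulInvariantVectorField X) s) (g : G) :
    IsMIntegralCurveOn (I := 𝓘(ℝ, E)) (fun t => g * γ t) (mulInvariantVectorField X) s := by
  intro t ht
  have h1 := (((contMDiff_mul_left' (E := E) g).contMDiffAt (x := γ t)).mdifferentiableAt
    (by simp)).hasMFDerivAt
  have h2 := h1.comp_hasMFDerivWithinAt t (hγ t ht)
  refine h2.congr_mfderiv (ContinuousLinearMap.ext fun r : ℝ => ?_)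
  change (mfderiv 𝓘(ℝ, E) 𝓘(ℝ, E) (fun k : G => g * k) (γ t) : E →L[ℝ] E)
    (r • (mulInvariantVectorField X (γ t) : E)) = r • (mulInvariantVectorField X (g * γ t) : E)
  rw [map_smul]
  exact congrArg (fun e : E => r • e) (mfderiv_mul_left_leftInvariant X g (γ t))

theorem IsMIntegralCurve.mul_left {X : GroupLieAlgebra 𝓘(ℝ, E) G} {γ : ℝ → G}
    (hγ : IsMIntegralCurve (I := 𝓘(ℝ, E)) γ (mulInvariantVectorField X)) (g : G) :
    IsMIntegralCurve (I := 𝓘(ℝ, E)) (fun t => g * γ t) (mulInvariantVectorField X) := by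
  rw [isMIntegralCurve_iff_isMIntegralCurveOn] at *
  exact IsMIntegralCurveOn.mul_left hγ g

/-- A local integral curve through the identity, left translated, gives integral curves through
every point on the same time interval. A uniform existence time implies completeness. -/
theorem exists_isMIntegralCurve_leftInvariant (X : GroupLieAlgebra 𝓘(ℝ, E) G) :
    ∃ γ : ℝ → G, γ 0 = 1 ∧ IsMIntegralCurve (I := 𝓘(ℝ, E)) γ (mulInvariantVectorField X) := by
  have : CompleteSpace E := FiniteDimensional.complete ℝ E
  have : IsManifold 𝓘(ℝ, E) 1 G := IsManifold.of_le (n := ∞) (by simp)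
  have hX := contMDiff_leftInvariant X
  obtain ⟨γ, h0, hγ⟩ := exists_isMIntegralCurveAt_of_contMDiffAt_boundaryless
    (I := 𝓘(ℝ, E)) (t₀ := 0) (x₀ := (1 : G)) hX.contMDiffAt
  obtain ⟨ε, hε, hγ⟩ := isMIntegralCurveAt_iff'.1 hγ
  refine exists_isMIntegralCurve_of_isMIntegralCurveOn hX hε (fun g => ⟨fun t => g * γ t, ?_, ?_⟩) 1
  · simp [h0]
  · have := IsMIntegralCurveOn.mul_left hγ g
    rwa [Real.ball_eq_Ioo, zero_sub, zero_add] at this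

theorem isMIntegralCurve_leftInvariant_unique {X : GroupLieAlgebra 𝓘(ℝ, E) G} {γ γ' : ℝ → G}
    (hγ : IsMIntegralCurve (I := 𝓘(ℝ, E)) γ (mulInvariantVectorField X))
    (hγ' : IsMIntegralCurve (I := 𝓘(ℝ, E)) γ' (mulInvariantVectorField X)) (h : γ 0 = γ' 0) :
    γ = γ' := by
  have : CompleteSpace E := FiniteDimensional.complete ℝ E
  have : IsManifold 𝓘(ℝ, E) 1 G := IsManifold.of_le (n := ∞) (by simp)
  exact isMIntegralCurve_Ioo_eq_of_contMDiff_boundaryless (t₀ := 0) (contMDiff_leftInvariant X)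
    hγ hγ' h

/-- Uniqueness of integral curves makes the choice in the definition of `lieExp` immaterial. -/
theorem lieExp_eq {X : GroupLieAlgebra 𝓘(ℝ, E) G} {γ : ℝ → G} (h0 : γ 0 = 1)
    (hγ : IsMIntegralCurve (I := 𝓘(ℝ, E)) γ (mulInvariantVectorField X)) : lieExp X = γ 1 := by
  have h : ∃ γ : ℝ → G, γ 0 = 1 ∧
      IsMIntegralCurve (I := 𝓘(ℝ, E)) γ (mulInvariantVectorField X) := ⟨γ, h0, hγ⟩
  rw [lieExp, dif_pos h, isMIntegralCurve_leftInvariant_unique h.choose_spec.2 hγ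
    (h.choose_spec.1.trans h0.symm)]

theorem lieExp_smul_eq {X : GroupLieAlgebra 𝓘(ℝ, E) G} {γ : ℝ → G} (h0 : γ 0 = 1)
    (hγ : IsMIntegralCurve (I := 𝓘(ℝ, E)) γ (mulInvariantVectorField X)) (t : ℝ) :
    lieExp (t • X) = γ t := by
  have h := hγ.comp_mul t
  rw [← mulInvariantVectorField_smul] at h
  rw [lieExp_eq (by simp [h0]) h]
  simp

theorem isMIntegralCurve_lieExp (X : GroupLieAlgebra 𝓘(ℝ, E) G) :
    IsMIntegralCurve (I := 𝓘(ℝ, E)) (fun t : ℝ => (lieExp (t • X) : G))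
      (mulInvariantVectorField X) := by
  obtain ⟨γ, h0, hγ⟩ := exists_isMIntegralCurve_leftInvariant X
  rwa [show (fun t : ℝ => (lieExp (t • X) : G)) = γ from funext (lieExp_smul_eq h0 hγ)]

theorem lieExp_zero_smul (X : GroupLieAlgebra 𝓘(ℝ, E) G) : (lieExp ((0 : ℝ) • X) : G) = 1 := by
  obtain ⟨γ, h0, hγ⟩ := exists_isMIntegralCurve_leftInvariant X
  rw [lieExp_smul_eq h0 hγ, h0]

theorem lieExp_zero : (lieExp (0 : GroupLieAlgebra 𝓘(ℝ, E) G) : G) = 1 := by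
  have h := lieExp_zero_smul (0 : GroupLieAlgebra 𝓘(ℝ, E) G)
  rwa [smul_zero] at h

theorem lieExp_add_smul (X : GroupLieAlgebra 𝓘(ℝ, E) G) (s t : ℝ) :
    (lieExp ((s + t) • X) : G) = lieExp (s • X) * lieExp (t • X) := by
  have h1 := IsMIntegralCurve.mul_left (isMIntegralCurve_lieExp X) (lieExp (s • X))
  have h2 := (isMIntegralCurve_lieExp X).comp_add s
  have := isMIntegralCurve_leftInvariant_unique h2 h1 (by simp [lieExp_zero])
  have := congrFun this t
  simpa [add_comm] using this

theorem lieExp_neg_smul (X : GroupLieAlgebra 𝓘(ℝ, E) G) (t : ℝ) :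
    (lieExp ((-t) • X) : G) = (lieExp (t • X))⁻¹ := by
  rw [eq_inv_iff_mul_eq_one, ← lieExp_add_smul, neg_add_cancel, lieExp_zero_smul]

theorem hasDerivAt_of_comp_smulRight {V F : Type*} [NormedAddCommGroup V] [NormedSpace ℝ V]
    [NormedAddCommGroup F] [NormedSpace ℝ F] {f : ℝ → F} {L : V →L[ℝ] F} {v : V} {t : ℝ}
    (h : HasFDerivAt f (L.comp ((1 : ℝ →L[ℝ] ℝ).smulRight v)) t) : HasDerivAt f (L v) t := by
  simpa using h.hasDerivAt

/-- The derivative of a function along the flow of a left-invariant vector field. -/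
theorem hasDerivAt_comp_mul_lieExp {F : Type*} [NormedAddCommGroup F] [NormedSpace ℝ F]
    (X : GroupLieAlgebra 𝓘(ℝ, E) G) {f : G → F} (g : G) (t : ℝ)
    (hf : MDifferentiableAt 𝓘(ℝ, E) 𝓘(ℝ, F) f (g * lieExp (t • X))) :
    HasDerivAt (fun s : ℝ => f (g * lieExp (s • X)))
      (leftDeriv X f (g * lieExp (t • X))) t := by
  have h1 := IsMIntegralCurve.mul_left (isMIntegralCurve_lieExp X) g t
  have h2 := hf.hasMFDerivAt.comp t h1
  have h3 : HasFDerivAt (fun s : ℝ => f (g * lieExp (s • X)))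
      ((mfderiv 𝓘(ℝ, E) 𝓘(ℝ, F) f (g * lieExp (t • X)) : E →L[ℝ] F).comp
        ((1 : ℝ →L[ℝ] ℝ).smulRight (mulInvariantVectorField X (g * lieExp (t • X)) : E))) t :=
    (hasMFDerivAt_iff_hasFDerivAt (𝕜 := ℝ) (E := ℝ) (E' := F)).1 h2
  exact hasDerivAt_of_comp_smulRight (V := E) (F := F) h3

theorem leftDeriv_sum_smul {F : Type*} [NormedAddCommGroup F] [NormedSpace ℝ F] {ι : Type*}
    [Fintype ι] (X : ι → GroupLieAlgebra 𝓘(ℝ, E) G) (c : ι → ℝ) (f : G → F) (g : G) :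
    leftDeriv (∑ i, c i • X i) f g = ∑ i, c i • leftDeriv (X i) f g := by
  have : mulInvariantVectorField (I := 𝓘(ℝ, E)) (∑ i, c i • X i) g
      = ∑ i, c i • mulInvariantVectorField (X i) g := by
    unfold mulInvariantVectorField
    rw [map_sum]
    exact Finset.sum_congr rfl fun i _ => map_smul _ _ _
  unfold leftDeriv
  rw [this, map_sum]
  exact Finset.sum_congr rfl fun i _ => map_smul _ _ _

end Flow

/-! ### A second order Taylor estimate -/

/-- The mean value inequality applied twice, first to `v'` and then to `v t - t • v' 0`. The sharp
factor `1/2` is not pursued. -/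
theorem norm_taylor_two_le {V : Type*} [NormedAddCommGroup V] [NormedSpace ℝ V]
    {v v' v'' : ℝ → V} (h1 : ∀ t, HasDerivAt v (v' t) t) (h2 : ∀ t, HasDerivAt v' (v'' t) t)
    {M : ℝ} (hM : ∀ t, ‖v'' t‖ ≤ M) : ‖v 1 - v 0 - v' 0‖ ≤ M := by
  have hM0 : 0 ≤ M := (norm_nonneg _).trans (hM 0)
  have h3 : ∀ t ∈ Icc (0 : ℝ) 1, ‖v' t - v' 0‖ ≤ M := by
    intro t ht
    have := (convex_Icc (0 : ℝ) 1).norm_image_sub_le_of_norm_hasDerivWithin_le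
      (fun x _ => (h2 x).hasDerivWithinAt) (fun x _ => hM x) (left_mem_Icc.2 zero_le_one) ht
    refine this.trans ?_
    rw [sub_zero, Real.norm_of_nonneg ht.1]
    exact mul_le_of_le_one_right hM0 ht.2
  have h4 : ∀ t, HasDerivAt (fun t => v t - t • v' 0) (v' t - v' 0) t := fun t => by
    have := (h1 t).sub ((hasDerivAt_id t).smul_const (v' 0))
    rwa [one_smul] at this
  have := (convex_Icc (0 : ℝ) 1).norm_image_sub_le_of_norm_hasDerivWithin_le
    (fun x _ => (h4 x).hasDerivWithinAt) h3 (left_mem_Icc.2 zero_le_one)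
    (right_mem_Icc.2 zero_le_one)
  simp only [one_smul, zero_smul, sub_zero, norm_one, mul_one] at this
  rwa [sub_right_comm]

/-! ### Weak derivatives and translations -/

section Weak

variable {E : Type*} [NormedAddCommGroup E] [NormedSpace ℝ E] [FiniteDimensional ℝ E]
  {G : Type*} [TopologicalSpace G] [ChartedSpace E G] [Group G] [LieGroup 𝓘(ℝ, E) ∞ G]
  [T2Space G] [CompactSpace G] [MeasurableSpace G] [BorelSpace G]
  {m : Measure G}

/-- Differentiation under the integral: compactness bounds `φ'` uniformly along the flow, so a
multiple of `‖F‖` dominates for all times. The scalar field is general so that `φ` may be a real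
test function or a complex product. -/
theorem hasDerivAt_integral_flow [IsFiniteMeasure m] {𝕜 : Type*} [RCLike 𝕜] {V : Type*}
    [NormedAddCommGroup V]
    [NormedSpace ℝ V] [NormedSpace 𝕜 V] [IsScalarTower ℝ 𝕜 V] {X : GroupLieAlgebra 𝓘(ℝ, E) G}
    {φ φ' : G → 𝕜} (hφ : Continuous φ) (hφ' : Continuous φ')
    (hd : ∀ g t, HasDerivAt (fun s : ℝ => φ (g * lieExp (s • X))) (φ' (g * lieExp (t • X))) t)
    {F : G → V} (hF : Integrable F m) (t : ℝ) :
    HasDerivAt (fun s : ℝ => ∫ g, φ (g * lieExp (s • X)) • F g ∂m)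
      (∫ g, φ' (g * lieExp (t • X)) • F g ∂m) t := by
  have : IsTopologicalGroup G := topologicalGroup_of_lieGroup 𝓘(ℝ, E) ∞
  have hm : ∀ {ψ : G → 𝕜}, Continuous ψ → ∀ h : G,
      AEStronglyMeasurable (fun g => ψ (g * h) • F g) m := fun hψ h =>
    (hψ.comp (continuous_mul_const h)).aestronglyMeasurable.smul hF.aestronglyMeasurable
  have hb : ∀ {ψ : G → 𝕜}, Continuous ψ → ∃ C, ∀ g, ‖ψ g‖ ≤ C := fun hψ => by
    obtain ⟨C, hC⟩ := isCompact_univ.exists_bound_of_continuousOn hψ.continuousOn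
    exact ⟨C, fun g => hC g (mem_univ g)⟩
  obtain ⟨C, hC⟩ := hb hφ
  obtain ⟨C', hC'⟩ := hb hφ'
  refine (hasDerivAt_integral_of_dominated_loc_of_deriv_le (𝕜 := ℝ) (s := univ)
    (bound := fun g => C' * ‖F g‖)
    (F := fun s g => φ (g * lieExp (s • X)) • F g)
    (F' := fun s g => φ' (g * lieExp (s • X)) • F g)
    univ_mem (Eventually.of_forall fun s => hm hφ _) ?_ (hm hφ' _) ?_ (hF.norm.const_mul C') ?_).2
  · refine (hF.norm.const_mul C).mono' (hm hφ _) (Eventually.of_forall fun g => ?_)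
    rw [norm_smul]
    exact mul_le_mul_of_nonneg_right (hC _) (norm_nonneg _)
  · refine Eventually.of_forall fun g s _ => ?_
    rw [norm_smul]
    exact mul_le_mul_of_nonneg_right (hC' _) (norm_nonneg _)
  · exact Eventually.of_forall fun g s _ => (hd g s).smul_const (F g)

theorem hasDerivAt_flow_of_contMDiff (X : GroupLieAlgebra 𝓘(ℝ, E) G) {φ : G → ℝ}
    (hφ : ContMDiff 𝓘(ℝ, E) 𝓘(ℝ, ℝ) ∞ φ) (g : G) (t : ℝ) :
    HasDerivAt (fun s : ℝ => φ (g * lieExp (s • X))) (leftDeriv X φ (g * lieExp (t • X))) t :=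
  hasDerivAt_comp_mul_lieExp X g t (hφ.contMDiffAt.mdifferentiableAt (by simp))

/-- The field `X` is invariant under its own flow, because elements of one one-parameter subgroup
commute. -/
theorem leftDeriv_comp_mul_lieExp (X : GroupLieAlgebra 𝓘(ℝ, E) G) {φ : G → ℝ}
    (hφ : ContMDiff 𝓘(ℝ, E) 𝓘(ℝ, ℝ) ∞ φ) (g : G) (t : ℝ) :
    leftDeriv X (fun h => φ (h * lieExp (t • X))) g = leftDeriv X φ (g * lieExp (t • X)) := by
  have h1 := hasDerivAt_flow_of_contMDiff X (hφ.comp (contMDiff_mul_right' (lieExp (t • X)))) g 0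
  have h2 := hasDerivAt_flow_of_contMDiff X hφ g t
  have h3 : HasDerivAt (fun s : ℝ => φ (g * lieExp ((s + t) • X)))
      (leftDeriv X φ (g * lieExp (t • X))) 0 :=
    HasDerivAt.comp_add_const 0 t (by simpa using h2)
  simp only [lieExp_add_smul, Function.comp_def, ← mul_assoc] at h3 h1
  rw [lieExp_zero_smul, mul_one] at h1
  exact h1.unique h3

/-- A translated test function is again a test function, so the weak derivative can be tested at
every time `t`. This turns weak differentiability into classical differentiability of a scalar
function. -/
theorem hasDerivAt_integral_of_isWeakLeftDeriv [IsFiniteMeasure m]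
    {X : GroupLieAlgebra 𝓘(ℝ, E) G} {f h : G → ℂ} (hf : Integrable f m)
    (H : IsWeakLeftDeriv m X f h) {φ : G → ℝ} (hφ : ContMDiff 𝓘(ℝ, E) 𝓘(ℝ, ℝ) ∞ φ) (t : ℝ) :
    HasDerivAt (fun s : ℝ => ∫ g, φ (g * lieExp (s • X)) • f g ∂m)
      (-∫ g, φ (g * lieExp (t • X)) • h g ∂m) t := by
  have h1 := hasDerivAt_integral_flow (m := m) hφ.continuous (continuous_leftDeriv X hφ)
    (hasDerivAt_flow_of_contMDiff X hφ) hf t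
  have h2 := H _ (hφ.comp (contMDiff_mul_right' (lieExp (t • X))))
  simp only [Function.comp_def, leftDeriv_comp_mul_lieExp X hφ] at h2
  rwa [h2] at h1

/-- Classical derivatives along the flow are weak derivatives. -/
theorem isWeakLeftDeriv_of_hasDerivAt [IsFiniteMeasure m] [m.IsMulRightInvariant]
    {X : GroupLieAlgebra 𝓘(ℝ, E) G} {f f' : G → ℂ} (hf : Continuous f) (hf' : Continuous f')
    (hd : ∀ g t, HasDerivAt (fun s : ℝ => f (g * lieExp (s • X))) (f' (g * lieExp (t • X))) t) :
    IsWeakLeftDeriv m X f f' := by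
  have : IsTopologicalGroup G := topologicalGroup_of_lieGroup 𝓘(ℝ, E) ∞
  intro φ hφ
  have c1 := continuous_leftDeriv X hφ
  have c2 := hφ.continuous
  have h1 := hasDerivAt_integral_flow (𝕜 := ℂ) (V := ℂ) (m := m) (X := X)
    (φ := fun g => φ g • f g) (φ' := fun g => φ g • f' g + leftDeriv X φ g • f g)
    (F := fun _ => (1 : ℂ)) (c2.smul hf) ((c2.smul hf').add (c1.smul hf))
    (fun g t => (hasDerivAt_flow_of_contMDiff X hφ g t).smul (hd g t)) (integrable_const _) 0
  -- By right invariance the integral of `φ f` along the flow is constant, so the integral of the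
  -- product rule derivative vanishes: this is integration by parts.
  have h2 : ∀ s : ℝ, ∫ g, (φ (g * lieExp (s • X)) • f (g * lieExp (s • X))) • (1 : ℂ) ∂m
      = ∫ g, (φ g • f g) • (1 : ℂ) ∂m := fun s =>
    integral_mul_right_eq_self (μ := m) (fun g => (φ g • f g) • (1 : ℂ)) _
  simp only [h2] at h1
  have h3 := h1.unique (hasDerivAt_const (0 : ℝ) _)
  have i1 : Integrable (fun g => leftDeriv X φ g • f g) m :=
    (c1.smul hf).integrable_of_hasCompactSupport (HasCompactSupport.of_compactSpace _)
  have i2 : Integrable (fun g => φ g • f' g) m :=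
    (c2.smul hf').integrable_of_hasCompactSupport (HasCompactSupport.of_compactSpace _)
  rw [lieExp_zero_smul] at h3
  simp only [mul_one, smul_eq_mul] at h3
  rw [integral_add i2 i1, add_eq_zero_iff_eq_neg'] at h3
  exact h3

theorem IsWeakLeftDeriv.sum_smul [IsFiniteMeasure m] {ι : Type*} [Fintype ι]
    {X : ι → GroupLieAlgebra 𝓘(ℝ, E) G} {f : G → ℂ} {D : ι → G → ℂ} (hf : MemLp f 2 m)
    (hD : ∀ i, MemLp (D i) 2 m) (H : ∀ i, IsWeakLeftDeriv m (X i) f (D i)) (c : ι → ℝ) :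
    IsWeakLeftDeriv m (∑ i, c i • X i) f (fun g => ∑ i, c i • D i g) := by
  intro φ hφ
  have i1 : ∀ i ∈ Finset.univ, Integrable (fun g => c i • leftDeriv (X i) φ g • f g) m := fun i _ =>
    (integrable_smul_of_memLp (continuous_leftDeriv (X i) hφ) hf).smul (c i)
  have i2 : ∀ i ∈ Finset.univ, Integrable (fun g => c i • φ g • D i g) m := fun i _ =>
    (integrable_smul_of_memLp hφ.continuous (hD i)).smul (c i)
  simp only [leftDeriv_sum_smul, Finset.sum_smul, Finset.smul_sum, smul_assoc,
    smul_comm (φ _) (c _)]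
  rw [integral_finsetSum _ i1, integral_finsetSum _ i2, ← Finset.sum_neg_distrib]
  refine Finset.sum_congr rfl fun i _ => ?_
  rw [integral_smul, integral_smul, H i φ hφ, smul_neg]

theorem IsWeakLeftDeriv.sum_left [IsFiniteMeasure m] {ι : Type*} [Fintype ι]
    {X : GroupLieAlgebra 𝓘(ℝ, E) G} {f D : ι → G → ℂ} (hf : ∀ i, MemLp (f i) 2 m)
    (hD : ∀ i, MemLp (D i) 2 m) (H : ∀ i, IsWeakLeftDeriv m X (f i) (D i)) (c : ι → ℝ) :
    IsWeakLeftDeriv m X (fun g => ∑ i, c i • f i g) (fun g => ∑ i, c i • D i g) := by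
  intro φ hφ
  have i1 : ∀ i ∈ Finset.univ, Integrable (fun g => c i • leftDeriv X φ g • f i g) m := fun i _ =>
    (integrable_smul_of_memLp (continuous_leftDeriv X hφ) (hf i)).smul (c i)
  have i2 : ∀ i ∈ Finset.univ, Integrable (fun g => c i • φ g • D i g) m := fun i _ =>
    (integrable_smul_of_memLp hφ.continuous (hD i)).smul (c i)
  simp only [Finset.smul_sum, smul_comm _ (c _)]
  rw [integral_finsetSum _ i1, integral_finsetSum _ i2, ← Finset.sum_neg_distrib]
  refine Finset.sum_congr rfl fun i _ => ?_
  rw [integral_smul, integral_smul, H i φ hφ, smul_neg]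

/-- Uniqueness of weak derivatives, by the fundamental lemma of the calculus of variations. -/
theorem ae_eq_zero_of_isWeakLeftDeriv [IsFiniteMeasure m] {X : GroupLieAlgebra 𝓘(ℝ, E) G}
    {f h : G → ℂ} (hh : MemLp h 2 m) (H : IsWeakLeftDeriv m X f h) (hf : f =ᵐ[m] 0) :
    h =ᵐ[m] 0 := by
  refine ae_eq_zero_of_integral_contMDiff_smul_eq_zero 𝓘(ℝ, E)
    (hh.integrable one_le_two).locallyIntegrable fun φ hφ _ => ?_
  have h1 := H φ hφ
  have h2 : ∫ g, leftDeriv X φ g • f g ∂m = 0 := by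
    refine integral_eq_zero_of_ae ?_
    filter_upwards [hf] with g hg
    simp [hg]
  rw [h2] at h1
  exact neg_eq_zero.1 h1.symm

end Weak

/-! ### Duality with smooth functions -/

section Duality

variable {E : Type*} [NormedAddCommGroup E] [NormedSpace ℝ E] [FiniteDimensional ℝ E]
  {M : Type*} [TopologicalSpace M] [ChartedSpace E M] [IsManifold 𝓘(ℝ, E) ∞ M]
  [T2Space M] [CompactSpace M] [MeasurableSpace M] [BorelSpace M]
  {m : Measure M} [IsFiniteMeasure m]

theorem norm_integral_smul_le {φ : M → ℝ} (hφ : MemLp φ 2 m) {w : M → ℂ} (hw : MemLp w 2 m) :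
    ‖∫ x, φ x • w x ∂m‖ ≤ (eLpNorm φ 2 m).toReal * (eLpNorm w 2 m).toReal := by
  have h1 := eLpNorm_smul_le_mul_eLpNorm (p := 2) (q := 2) (r := 1) hw.1 hφ.1
  rw [← ENNReal.toReal_mul]
  refine le_trans ?_ (ENNReal.toReal_mono (ENNReal.mul_ne_top hφ.eLpNorm_ne_top hw.eLpNorm_ne_top) h1)
  rw [eLpNorm_one_eq_lintegral_enorm]
  have := enorm_integral_le_lintegral_enorm (μ := m) fun x => φ x • w x
  have h2 := ENNReal.toReal_mono ?_ this
  · simpa using h2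
  · rw [← eLpNorm_one_eq_lintegral_enorm]
    exact (h1.trans_lt (ENNReal.mul_lt_top hφ.2 hw.2)).ne

theorem integrable_smul_two {φ : M → ℝ} (hφ : Continuous φ) {f : M → ℂ} (hf : MemLp f 2 m) :
    Integrable (fun g => φ g • f g) m := by
  obtain ⟨C, hC⟩ := isCompact_univ.exists_bound_of_continuousOn hφ.continuousOn
  exact (hf.integrable one_le_two).bdd_smul C hφ.aestronglyMeasurable
    (Eventually.of_forall fun g => hC g (mem_univ g))

theorem ContMDiff.memLp_two {φ : M → ℝ} (hφ : ContMDiff 𝓘(ℝ, E) 𝓘(ℝ, ℝ) ∞ φ) :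
    MemLp φ 2 m :=
  hφ.continuous.memLp_of_hasCompactSupport (HasCompactSupport.of_compactSpace _)

/-- Smooth functions are dense in `L²`, their orthogonal complement being trivial by the fundamental
lemma. The bound thus extends to all of `L²`, and testing with `u` itself gives `‖u‖² ≤ C ‖u‖`. -/
theorem eLpNorm_le_of_forall_integral_mul_le {u : M → ℝ} (hu : MemLp u 2 m) {C : ℝ} (hC0 : 0 ≤ C)
    (hC : ∀ φ : M → ℝ, ContMDiff 𝓘(ℝ, E) 𝓘(ℝ, ℝ) ∞ φ →
      |∫ x, φ x * u x ∂m| ≤ C * (eLpNorm φ 2 m).toReal) :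
    (eLpNorm u 2 m).toReal ≤ C := by
  let S : Submodule ℝ (Lp ℝ 2 m) :=
    { carrier := {s | ∃ φ : M → ℝ, ContMDiff 𝓘(ℝ, E) 𝓘(ℝ, ℝ) ∞ φ ∧ s =ᵐ[m] φ}
      zero_mem' := ⟨0, contMDiff_const, Lp.coeFn_zero ℝ 2 m⟩
      add_mem' := by
        rintro a b ⟨φ, hφ, ha⟩ ⟨ψ, hψ, hb⟩
        exact ⟨φ + ψ, hφ.add hψ, (Lp.coeFn_add a b).trans (ha.add hb)⟩
      smul_mem' := by
        rintro c a ⟨φ, hφ, ha⟩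
        exact ⟨c • φ, (contDiff_const_smul c).contMDiff.comp hφ, (Lp.coeFn_smul c a).trans (ha.const_smul c)⟩ }
  have hin : ∀ (s v : Lp ℝ 2 m) (φ w : M → ℝ), s =ᵐ[m] φ → v =ᵐ[m] w →
      inner ℝ s v = ∫ x, φ x * w x ∂m := by
    intro s v φ w hs hv
    rw [L2.inner_def]
    refine integral_congr_ae ?_
    filter_upwards [hs, hv] with x h1 h2
    simp [h1, h2, mul_comm]
  have hS : S.topologicalClosure = ⊤ := by
    rw [Submodule.topologicalClosure_eq_top_iff, Submodule.eq_bot_iff]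
    intro v hv
    rw [Submodule.mem_orthogonal] at hv
    have : ∀ᵐ x ∂m, v x = 0 := by
      refine ae_eq_zero_of_integral_contMDiff_smul_eq_zero 𝓘(ℝ, E)
        ((Lp.memLp v).integrable one_le_two).locallyIntegrable fun φ hφ _ => ?_
      have hφ2 : MemLp φ 2 m := ContMDiff.memLp_two hφ
      have := hv (hφ2.toLp φ) ⟨φ, hφ, hφ2.coeFn_toLp⟩
      rwa [hin _ _ φ v hφ2.coeFn_toLp (ae_eq_refl _)] at this
    exact (Lp.eq_zero_iff_ae_eq_zero).2 this
  have hcl : ∀ s ∈ S.topologicalClosure, inner ℝ s (hu.toLp u) ≤ C * ‖s‖ := by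
    intro s hs
    have hclosed : IsClosed {s : Lp ℝ 2 m | inner ℝ s (hu.toLp u) ≤ C * ‖s‖} :=
      isClosed_le (by fun_prop) (by fun_prop)
    refine closure_minimal (fun s hs => ?_) hclosed hs
    obtain ⟨φ, hφ, hsφ⟩ := hs
    have h2 : ‖s‖ = (eLpNorm φ 2 m).toReal := by rw [Lp.norm_def, eLpNorm_congr_ae hsφ]
    rw [mem_ofPred, hin _ _ φ u hsφ hu.coeFn_toLp, h2]
    exact (le_abs_self _).trans (hC φ hφ)
  have h := hcl (hu.toLp u) (hS ▸ Submodule.mem_top)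
  rw [real_inner_self_eq_norm_mul_norm, Lp.norm_toLp] at h
  rcases (ENNReal.toReal_nonneg (a := eLpNorm u 2 m)).eq_or_lt with h0 | h0
  · rw [← h0]
    exact hC0
  · exact le_of_mul_le_mul_right h h0

/-- Test functions are real, so real and imaginary parts are bounded separately; adding the two
bounds produces the factor `2`. -/
theorem eLpNorm_le_of_forall_norm_integral_smul_le {w : M → ℂ} (hw : MemLp w 2 m) {C : ℝ} (hC0 : 0 ≤ C)
    (hC : ∀ φ : M → ℝ, ContMDiff 𝓘(ℝ, E) 𝓘(ℝ, ℝ) ∞ φ →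
      ‖∫ x, φ x • w x ∂m‖ ≤ C * (eLpNorm φ 2 m).toReal) :
    eLpNorm w 2 m ≤ ENNReal.ofReal (2 * C) := by
  have hre : (eLpNorm (fun x => (w x).re) 2 m).toReal ≤ C := by
    refine eLpNorm_le_of_forall_integral_mul_le (E := E) hw.re hC0 fun φ hφ => ?_
    refine le_trans ?_ (hC φ hφ)
    have h1 := integral_re (𝕜 := ℂ) (integrable_smul_two hφ.continuous hw)
    simp only [RCLike.re_to_complex, Complex.smul_re, smul_eq_mul] at h1
    refine (congrArg abs h1).trans_le ?_
    exact Complex.abs_re_le_norm _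
  have him : (eLpNorm (fun x => (w x).im) 2 m).toReal ≤ C := by
    refine eLpNorm_le_of_forall_integral_mul_le (E := E) hw.im hC0 fun φ hφ => ?_
    refine le_trans ?_ (hC φ hφ)
    have h1 := integral_im (𝕜 := ℂ) (integrable_smul_two hφ.continuous hw)
    simp only [RCLike.im_to_complex, Complex.smul_im, smul_eq_mul] at h1
    refine (congrArg abs h1).trans_le ?_
    exact Complex.abs_im_le_norm _
  calc eLpNorm w 2 m
      ≤ eLpNorm ((fun x => ‖(w x).re‖) + fun x => ‖(w x).im‖) 2 m :=
        eLpNorm_mono_real fun x => Complex.norm_le_abs_re_add_abs_im (w x)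
    _ ≤ eLpNorm (fun x => ‖(w x).re‖) 2 m + eLpNorm (fun x => ‖(w x).im‖) 2 m :=
        eLpNorm_add_le hw.re.norm.1 hw.im.norm.1 one_le_two
    _ = eLpNorm (fun x => (w x).re) 2 m + eLpNorm (fun x => (w x).im) 2 m := by
        rw [eLpNorm_norm, eLpNorm_norm]
    _ ≤ ENNReal.ofReal C + ENNReal.ofReal C := by
        refine add_le_add ?_ ?_
        · exact (ENNReal.le_ofReal_iff_toReal_le hw.re.eLpNorm_ne_top hC0).2 hre
        · exact (ENNReal.le_ofReal_iff_toReal_le hw.im.eLpNorm_ne_top hC0).2 him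
    _ = ENNReal.ofReal (2 * C) := by rw [← ENNReal.ofReal_add hC0 hC0, two_mul]

end Duality

/-! ### Taylor expansion in `L²` along right translations -/

section Taylor

variable {E : Type*} [NormedAddCommGroup E] [NormedSpace ℝ E] [FiniteDimensional ℝ E]
  {G : Type*} [TopologicalSpace G] [ChartedSpace E G] [Group G] [LieGroup 𝓘(ℝ, E) ∞ G]
  [T2Space G] [CompactSpace G] [MeasurableSpace G] [BorelSpace G]
  {m : Measure G} [IsFiniteMeasure m] [m.IsMulRightInvariant] {n : ℕ}
  {X : Fin n → GroupLieAlgebra 𝓘(ℝ, E) G} {F : G → ℂ} {D : Fin n → G → ℂ}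
  {D₂ : Fin n → Fin n → G → ℂ}

theorem lieExp_sum_neg_smul (X : Fin n → GroupLieAlgebra 𝓘(ℝ, E) G) (c : Fin n → ℝ) :
    (lieExp (∑ i, (-c i) • X i) : G) = (lieExp (∑ i, c i • X i))⁻¹ := by
  have h := lieExp_neg_smul (∑ i, c i • X i) 1
  rw [one_smul, neg_smul, one_smul] at h
  rw [← h]
  simp only [neg_smul, Finset.sum_neg_distrib]

theorem memLp_sum_smul {ι : Type*} [Fintype ι] {f : ι → G → ℂ} (hf : ∀ i, MemLp (f i) 2 m)
    (c : ι → ℝ) : MemLp (fun g => ∑ i, c i • f i g) 2 m :=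
  memLp_finsetSum _ fun i _ => (hf i).const_smul (c i)

theorem eLpNorm_sum_smul_le {ι : Type*} [Fintype ι] {f : ι → G → ℂ} (hf : ∀ i, MemLp (f i) 2 m)
    (c : ι → ℝ) :
    eLpNorm (fun g => ∑ i, c i • f i g) 2 m ≤ ∑ i, ‖c i‖ₑ * eLpNorm (f i) 2 m := by
  have h : (fun g => ∑ i, c i • f i g) = ∑ i, c i • f i := by
    funext g
    simp [Finset.sum_apply]
  rw [h]
  refine (eLpNorm_sum_le (fun i _ => ((hf i).const_smul (c i)).1) one_le_two).trans_eq ?_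
  exact Finset.sum_congr rfl fun i _ => eLpNorm_const_smul _ _ _ _

/-- With `Y = ∑ cᵢXᵢ` the witness is `YYF = ∑ cᵢcⱼ D₂ i j`, and `|cᵢcⱼ| ≤ ∑ cₖ²` gives the norm
bound. -/
theorem IsSobolevTwo.exists_weak_second (H : IsSobolevTwo m X F D D₂) (c : Fin n → ℝ) :
    ∃ H₂ : G → ℂ, MemLp H₂ 2 m ∧
      IsWeakLeftDeriv m (∑ i, c i • X i) (fun g => ∑ i, c i • D i g) H₂ ∧
      (eLpNorm H₂ 2 m).toReal ≤
        (∑ i, ∑ j, (eLpNorm (D₂ i j) 2 m).toReal) * ∑ i, c i ^ 2 := by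
  have m1 : ∀ i, MemLp (fun g => ∑ j, c j • D₂ i j g) 2 m := fun i =>
    memLp_sum_smul (H.memLp_second i) c
  refine ⟨fun g => ∑ i, c i • ∑ j, c j • D₂ i j g, memLp_sum_smul m1 c,
    IsWeakLeftDeriv.sum_smul (memLp_sum_smul H.memLp_first c) m1 (fun i =>
      IsWeakLeftDeriv.sum_left H.memLp_first (H.memLp_second i) (H.second i) c) c, ?_⟩
  have hsq : ∀ i, c i ^ 2 ≤ ∑ k, c k ^ 2 := fun i =>
    Finset.single_le_sum (fun k _ => sq_nonneg (c k)) (Finset.mem_univ i)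
  have h1 : eLpNorm (fun g => ∑ i, c i • ∑ j, c j • D₂ i j g) 2 m
      ≤ ∑ i, ‖c i‖ₑ * ∑ j, ‖c j‖ₑ * eLpNorm (D₂ i j) 2 m :=
    (eLpNorm_sum_smul_le m1 c).trans (Finset.sum_le_sum fun i _ =>
      mul_le_mul_right (eLpNorm_sum_smul_le (H.memLp_second i) c) _)
  have h0 : ∀ i, ∀ j ∈ Finset.univ, ‖c j‖ₑ * eLpNorm (D₂ i j) 2 m ≠ ⊤ := fun i j _ =>
    ENNReal.mul_ne_top enorm_ne_top (H.memLp_second i j).eLpNorm_ne_top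
  have h0' : ∀ i ∈ Finset.univ, ‖c i‖ₑ * ∑ j, ‖c j‖ₑ * eLpNorm (D₂ i j) 2 m ≠ ⊤ := fun i _ =>
    ENNReal.mul_ne_top enorm_ne_top (ENNReal.sum_ne_top.2 (h0 i))
  refine (ENNReal.toReal_mono (ENNReal.sum_ne_top.2 h0') h1).trans ?_
  rw [ENNReal.toReal_sum h0', Finset.sum_mul]
  refine Finset.sum_le_sum fun i _ => ?_
  rw [ENNReal.toReal_mul, ENNReal.toReal_sum (h0 i), Finset.sum_mul, Finset.mul_sum]
  refine Finset.sum_le_sum fun j _ => ?_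
  rw [ENNReal.toReal_mul, ← mul_assoc, mul_comm]
  refine mul_le_mul_of_nonneg_left ?_ ENNReal.toReal_nonneg
  simp only [toReal_enorm, Real.norm_eq_abs]
  have h2 := hsq i
  have h3 := hsq j
  rw [← sq_abs] at h2 h3
  nlinarith [sq_nonneg (|c i| - |c j|)]

/-- The `L²` estimate for the remainder of the first order Taylor expansion along right
translations. -/
theorem IsSobolevTwo.eLpNorm_taylor_le (H : IsSobolevTwo m X F D D₂) :
    ∃ C : ℝ, 0 ≤ C ∧ ∀ c : Fin n → ℝ,
      eLpNorm (fun g => F (g * lieExp (∑ i, c i • X i)) - F g - ∑ i, c i • D i g) 2 m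
        ≤ ENNReal.ofReal (C * ∑ i, c i ^ 2) := by
  have : IsTopologicalGroup G := topologicalGroup_of_lieGroup 𝓘(ℝ, E) ∞
  set K := ∑ i, ∑ j, (eLpNorm (D₂ i j) 2 m).toReal with hK
  have hK0 : 0 ≤ K := Finset.sum_nonneg fun i _ => Finset.sum_nonneg fun j _ =>
    ENNReal.toReal_nonneg
  refine ⟨2 * K, by positivity, fun c => ?_⟩
  set y : G := lieExp (∑ i, c i • X i) with hy
  -- Moving the translation from `F` to `φ` inverts it, so the flow acting on `φ` has direction `Z =
  -- -∑ cᵢXᵢ`.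
  set Z := ∑ i, (-c i) • X i with hZ
  have hyZ : y = (lieExp Z)⁻¹ := by rw [hZ, lieExp_sum_neg_smul, inv_inv]
  have mp := fun h : G => measurePreserving_mul_right m h
  have hFy : MemLp (fun g => F (g * y)) 2 m := H.memLp.comp_measurePreserving (mp y)
  have hDc := memLp_sum_smul H.memLp_first c
  have h1 := IsWeakLeftDeriv.sum_smul H.memLp H.memLp_first H.first fun i => -c i
  obtain ⟨H₂, hH₂, h2, h3⟩ := H.exists_weak_second fun i => -c i
  simp only [neg_sq] at h3
  rw [mul_assoc]
  refine eLpNorm_le_of_forall_norm_integral_smul_le (E := E) ((hFy.sub H.memLp).sub hDc)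
    (mul_nonneg hK0 (Finset.sum_nonneg fun i _ => sq_nonneg _)) fun φ hφ => ?_
  have d1 := hasDerivAt_integral_of_isWeakLeftDeriv (H.memLp.integrable one_le_two) h1 hφ
  have d2 := fun t => (hasDerivAt_integral_of_isWeakLeftDeriv
    ((memLp_sum_smul H.memLp_first fun i => -c i).integrable one_le_two) h2 hφ t).neg
  have hφ2 : MemLp φ 2 m := ContMDiff.memLp_two hφ
  -- The scalar function is `v t = ∫ φ(g exp(tZ)) F(g)`. Cauchy–Schwarz bounds `v''`, because right
  -- translation preserves the `L²` norm of `φ`.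
  have hb := norm_taylor_two_le d1 d2
    (M := (K * ∑ i, c i ^ 2) * (eLpNorm φ 2 m).toReal) fun t => by
      have hφt : MemLp (fun g => φ (g * lieExp (t • Z))) 2 m :=
        hφ2.comp_measurePreserving (mp _)
      have e : eLpNorm (fun g => φ (g * lieExp (t • Z))) 2 m = eLpNorm φ 2 m :=
        eLpNorm_comp_measurePreserving hφ2.1 (mp _)
      rw [neg_neg]
      refine (norm_integral_smul_le hφt hH₂).trans ?_
      rw [e, mul_comm]
      exact mul_le_mul_of_nonneg_right h3 ENNReal.toReal_nonneg
  refine le_of_eq_of_le ?_ hb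
  congr 1
  have e1 : ∫ g, φ (g * lieExp ((1 : ℝ) • Z)) • F g ∂m = ∫ g, φ g • F (g * y) ∂m := by
    rw [← integral_mul_right_eq_self (μ := m) (fun g => φ g • F (g * y)) (lieExp Z), one_smul]
    simp [hyZ]
  have i1 := integrable_smul_two hφ.continuous hFy
  have i2 := integrable_smul_two hφ.continuous H.memLp
  have i3 := integrable_smul_two hφ.continuous hDc
  have e2 : ∫ g, φ g • (F (g * y) - F g - ∑ i, c i • D i g) ∂m
      = ∫ g, φ g • F (g * y) ∂m - ∫ g, φ g • F g ∂m - ∫ g, φ g • ∑ i, c i • D i g ∂m := by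
    have i4 : Integrable (fun g => φ g • F (g * y) - φ g • F g) m := i1.sub i2
    rw [← integral_sub i1 i2, ← integral_sub i4 i3]
    simp only [smul_sub]
  rw [e1]
  simp only [Pi.sub_apply, lieExp_zero_smul, mul_one]
  simp only [neg_smul, Finset.sum_neg_distrib, smul_neg, integral_neg, neg_neg]
  exact e2

end Taylor

/-! ### Continuous homomorphisms into Banach algebras -/

section Hom

variable {E : Type*} [NormedAddCommGroup E] [NormedSpace ℝ E] [FiniteDimensional ℝ E]
  {G : Type*} [TopologicalSpace G] [ChartedSpace E G] [Group G] [LieGroup 𝓘(ℝ, E) ∞ G]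
  [T2Space G] [CompactSpace G]

/-- Inversion turns right invariance into left invariance. Full support makes the integral of a bump
function positive. -/
theorem isOpenPosMeasure_of_isMulRightInvariant [IsTopologicalGroup G] [MeasurableSpace G]
    [BorelSpace G] (m : Measure G) [m.IsMulRightInvariant] [NeZero m] :
    m.IsOpenPosMeasure := by
  have hu : m.inv (univ : Set G) ≠ 0 := by
    rw [Measure.inv_apply, Set.inv_univ]
    exact Measure.measure_univ_ne_zero.2 (NeZero.ne m)
  have := isOpenPosMeasure_of_mulLeftInvariant_of_compact (μ := m.inv) univ isCompact_univ hu
  refine ⟨fun V hV hne => ?_⟩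
  have := hV.inv.measure_ne_zero m.inv hne.inv
  rwa [Measure.inv_apply, inv_inv] at this

variable {R : Type*} [NormedRing R] [NormedAlgebra ℝ R] [CompleteSpace R] {P : G →* R}

/-- For a bump `φ` supported where `P` is within `1/2` of `1`, the average of `P` against `φ`,
normalised by `∫ φ`, is also within `1/2` of `1`, hence invertible by the Neumann series. -/
theorem exists_isUnit_integral [MeasurableSpace G] [BorelSpace G] (m : Measure G)
    [m.IsMulRightInvariant] [IsProbabilityMeasure m] (hP : Continuous P) :
    ∃ φ : G → ℝ, ContMDiff 𝓘(ℝ, E) 𝓘(ℝ, ℝ) ∞ φ ∧ IsUnit (∫ h, φ h • P h ∂m) := by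
  have : IsTopologicalGroup G := topologicalGroup_of_lieGroup 𝓘(ℝ, E) ∞
  have := isOpenPosMeasure_of_isMulRightInvariant m
  have hW : {h : G | ‖P h - 1‖ < 1 / 2} ∈ 𝓝 (1 : G) := by
    refine (isOpen_lt (hP.sub continuous_const).norm continuous_const).mem_nhds ?_
    simp
  obtain ⟨f, -, hf⟩ := (SmoothBumpFunction.nhds_basis_tsupport (I := 𝓘(ℝ, E)) (1 : G)).mem_iff.1 hW
  have hfs : ContMDiff 𝓘(ℝ, E) 𝓘(ℝ, ℝ) ∞ f := f.contMDiff
  have hfc := hfs.continuous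
  have hc : 0 < ∫ h, f h ∂m :=
    hfc.integral_pos_of_hasCompactSupport_nonneg_nonzero (x := 1)
      (HasCompactSupport.of_compactSpace _) (fun h => f.nonneg) (by simp)
  refine ⟨f, hfs, ?_⟩
  set c := ∫ h, f h ∂m with hcdef
  set A := ∫ h, f h • P h ∂m with hA
  have i1 : Integrable (fun h => f h • P h) m :=
    (hfc.smul hP).integrable_of_hasCompactSupport (HasCompactSupport.of_compactSpace _)
  have i2 : Integrable (fun h => f h • (1 : R)) m :=
    (hfc.smul continuous_const).integrable_of_hasCompactSupport
      (HasCompactSupport.of_compactSpace _)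
  have i3 : Integrable f m :=
    hfc.integrable_of_hasCompactSupport (HasCompactSupport.of_compactSpace _)
  have h1 : ‖c • (1 : R) - A‖ ≤ c * (1 / 2) := by
    have e : c • (1 : R) - A = ∫ h, (f h • (1 : R) - f h • P h) ∂m := by
      rw [integral_sub i2 i1, integral_smul_const]
    rw [e, hcdef, ← integral_mul_const]
    refine norm_integral_le_of_norm_le (i3.mul_const _) (Eventually.of_forall fun h => ?_)
    rw [← smul_sub, norm_smul, Real.norm_of_nonneg f.nonneg, norm_sub_rev]
    by_cases hh : h ∈ tsupport f
    · exact mul_le_mul_of_nonneg_left (hf hh).le f.nonneg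
    · have : f h = 0 := image_eq_zero_of_notMem_tsupport hh
      simp [this]
  have h2 : ‖1 - c⁻¹ • A‖ < 1 := by
    have e : 1 - c⁻¹ • A = c⁻¹ • (c • (1 : R) - A) := by
      rw [smul_sub, inv_smul_smul₀ hc.ne']
    rw [e, norm_smul, norm_inv, Real.norm_of_nonneg hc.le, inv_mul_lt_iff₀ hc]
    nlinarith
  have h3 : IsUnit (1 - (1 - c⁻¹ • A)) := isUnit_one_sub_of_norm_lt_one h2
  rw [sub_sub_cancel] at h3
  have h4 := h3.smul (Units.mk0 c hc.ne')
  rwa [Units.smul_mk0, smul_inv_smul₀ hc.ne'] at h4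

/-- A continuous homomorphism into a Banach algebra is differentiable along one-parameter
subgroups, and its derivative is linear. -/
theorem exists_hasDerivAt_hom [MeasurableSpace G] [BorelSpace G] (m : Measure G)
    [m.IsMulRightInvariant] [IsProbabilityMeasure m] (hP : Continuous P) :
    ∃ dP : GroupLieAlgebra 𝓘(ℝ, E) G → R,
      (∀ X g t, HasDerivAt (fun s : ℝ => P (g * lieExp (s • X)))
        (P (g * lieExp (t • X)) * dP X) t) ∧
      ∀ (n : ℕ) (X : Fin n → GroupLieAlgebra 𝓘(ℝ, E) G) (c : Fin n → ℝ),
        dP (∑ i, c i • X i) = ∑ i, c i • dP (X i) := by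
  have : IsTopologicalGroup G := topologicalGroup_of_lieGroup 𝓘(ℝ, E) ∞
  obtain ⟨φ, hφ, u, hu⟩ := exists_isUnit_integral (E := E) m hP
  have hPi : Integrable P m :=
    hP.integrable_of_hasCompactSupport (HasCompactSupport.of_compactSpace _)
  -- Right invariance and multiplicativity give `(∫ φ P) * P k = ∫ φ(hk⁻¹) P(h)`; the dependence on
  -- `k` is moved onto the smooth `φ`.
  have key : ∀ k : G, P k = ↑u⁻¹ * ∫ h, φ (h * k⁻¹) • P h ∂m := by
    intro k
    have e : ∫ h, φ (h * k⁻¹) • P h ∂m = u * P k := by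
      rw [← integral_mul_right_eq_self (μ := m) (fun h => φ (h * k⁻¹) • P h) k, hu,
        ← integral_mul_const_of_integrable]
      · simp
      · exact (hφ.continuous.smul hP).integrable_of_hasCompactSupport
          (HasCompactSupport.of_compactSpace _)
    rw [e, ← mul_assoc, Units.inv_mul, one_mul]
  -- The witness differentiates `key` along `k = exp(sX)` at `s = 0`; the sign comes from `k⁻¹ =
  -- exp(-sX)`. It is linear in `X` because `leftDeriv X φ` is.
  refine ⟨fun X => ↑u⁻¹ * -∫ h, leftDeriv X φ h • P h ∂m, fun X g t => ?_, fun n X c => ?_⟩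
  · have h1 := hasDerivAt_integral_flow (m := m) hφ.continuous (continuous_leftDeriv X hφ)
      (hasDerivAt_flow_of_contMDiff X hφ) hPi
    have h2 : HasDerivAt (fun s : ℝ => P (lieExp (s • X)))
        (↑u⁻¹ * -∫ h, leftDeriv X φ h • P h ∂m) 0 := by
      have h3 : HasDerivAt (fun s : ℝ => ∫ h, φ (h * lieExp ((-s) • X)) • P h ∂m)
          (-∫ h, leftDeriv X φ h • P h ∂m) 0 := by
        have h4 := h1 (-0)
        have h5 := h4.scomp (0 : ℝ) (hasDerivAt_neg (0 : ℝ))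
        simpa [Function.comp_def, lieExp_zero] using h5
      refine (h3.const_mul (↑u⁻¹ : R)).congr_of_eventuallyEq (Eventually.of_forall fun s => ?_)
      change P (lieExp (s • X)) = _
      simp only [lieExp_neg_smul]
      exact key _
    have h6 : HasDerivAt (fun s : ℝ => P (lieExp ((s - t) • X)))
        (↑u⁻¹ * -∫ h, leftDeriv X φ h • P h ∂m) t :=
      HasDerivAt.comp_sub_const t t (by rwa [sub_self])
    refine (h6.const_mul (P (g * lieExp (t • X)))).congr_of_eventuallyEq
      (Eventually.of_forall fun s => ?_)
    change P (g * lieExp (s • X)) = P (g * lieExp (t • X)) * P (lieExp ((s - t) • X))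
    rw [← map_mul, mul_assoc, ← lieExp_add_smul, add_sub_cancel]
  · have i1 : ∀ i ∈ Finset.univ, Integrable (fun h => c i • leftDeriv (X i) φ h • P h) m :=
      fun i _ => (((continuous_leftDeriv (X i) hφ).smul hP).integrable_of_hasCompactSupport
        (HasCompactSupport.of_compactSpace _)).smul (c i)
    simp only [leftDeriv_sum_smul, Finset.sum_smul, smul_assoc]
    rw [integral_finsetSum _ i1, ← Finset.sum_neg_distrib, Finset.mul_sum]
    refine Finset.sum_congr rfl fun i _ => ?_
    rw [integral_smul, ← smul_neg, mul_smul_comm]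

/-! ### Exponential formula, differentiability and Taylor bound for homomorphisms -/

variable {dP : GroupLieAlgebra 𝓘(ℝ, E) G → R}

/-- The product `P(exp(tX)) e^{-t dP X}` has zero derivative, hence is constant. -/
theorem hom_lieExp_eq_exp (X : GroupLieAlgebra 𝓘(ℝ, E) G)
    (hd : ∀ g t, HasDerivAt (fun s : ℝ => P (g * lieExp (s • X)))
      (P (g * lieExp (t • X)) * dP X) t) :
    P (lieExp X) = NormedSpace.exp (dP X) := by
  let _ : NormedAlgebra ℚ R := NormedAlgebra.restrictScalars ℚ ℝ R
  have h1 : ∀ t : ℝ, HasDerivAt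
      (fun t : ℝ => P (lieExp (t • X)) * NormedSpace.exp (t • (-dP X))) 0 t := by
    intro t
    have h2 := hd 1 t
    simp only [one_mul] at h2
    have h3 := h2.mul (hasDerivAt_exp_smul_const' (𝕂 := ℝ) (-dP X) t)
    rwa [mul_assoc, ← mul_add, neg_mul, add_neg_cancel, mul_zero] at h3
  have h2 := is_const_of_deriv_eq_zero (fun t => (h1 t).differentiableAt)
    (fun t => (h1 t).deriv) 1 0
  simp only [one_smul, zero_smul, lieExp_zero, map_one, one_mul, NormedSpace.exp_zero] at h2
  have h3 : NormedSpace.exp (-dP X) * NormedSpace.exp (dP X) = 1 := by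
    rw [← NormedSpace.exp_add_of_commute (Commute.refl (dP X)).neg_left, neg_add_cancel,
      NormedSpace.exp_zero]
  rw [← mul_one (P _), ← h3, ← mul_assoc, h2, one_mul]

/-- Near `g`, canonical coordinates give `P h = P g * exp(∑ xᵢ(g⁻¹h) dP(Xᵢ))`, a composition of
smooth coordinates with the analytic exponential. Derivatives along flows alone would not do:
`leftDeriv` is defined by `mfderiv`, which is zero by default at points of non-differentiability. -/
theorem mdifferentiableAt_hom
    (hd : ∀ X g t, HasDerivAt (fun s : ℝ => P (g * lieExp (s • X)))
      (P (g * lieExp (t • X)) * dP X) t)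
    (hlin : ∀ (n : ℕ) (X : Fin n → GroupLieAlgebra 𝓘(ℝ, E) G) (c : Fin n → ℝ),
      dP (∑ i, c i • X i) = ∑ i, c i • dP (X i))
    {n : ℕ} {X : Fin n → GroupLieAlgebra 𝓘(ℝ, E) G} {U : Set G} {x : Fin n → G → ℝ}
    (hx : ∀ i, ContMDiff 𝓘(ℝ, E) 𝓘(ℝ, ℝ) ∞ (x i)) (hU : IsCanonicalCoord X U x) (g : G) :
    MDifferentiableAt 𝓘(ℝ, E) 𝓘(ℝ, R) P g := by
  have : IsTopologicalGroup G := topologicalGroup_of_lieGroup 𝓘(ℝ, E) ∞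
  obtain ⟨hUo, hU1, V, -, -, -, -, -, hexp⟩ := hU
  have h1 : ContMDiff 𝓘(ℝ, E) 𝓘(ℝ, Fin n → ℝ) ∞ (fun h : G => fun i => x i (g⁻¹ * h)) :=
    contMDiff_pi_space.2 fun i => (hx i).comp (contMDiff_mul_left' g⁻¹)
  have h2 : Differentiable ℝ (fun c : Fin n → ℝ => P g * NormedSpace.exp (∑ i, c i • dP (X i))) := by
    intro c
    have h3 : DifferentiableAt ℝ (NormedSpace.exp : R → R) (∑ i, c i • dP (X i)) :=
      (NormedSpace.exp_analytic (𝕂 := ℝ) _).differentiableAt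
    have h4 : DifferentiableAt ℝ (fun c : Fin n → ℝ => ∑ i, c i • dP (X i)) c := by fun_prop
    exact (h3.comp c h4).const_mul (P g)
  have h3 := (h2 fun i => x i (g⁻¹ * g)).mdifferentiableAt.comp g
    (h1.contMDiffAt.mdifferentiableAt (by simp))
  refine h3.congr_of_eventuallyEq ?_
  have h4 : ∀ᶠ h in 𝓝 g, g⁻¹ * h ∈ U :=
    (continuous_const_mul g⁻¹).continuousAt.preimage_mem_nhds
      (hUo.mem_nhds (by simpa using hU1))
  filter_upwards [h4] with h hh
  have h5 : P (g⁻¹ * h) = NormedSpace.exp (∑ i, x i (g⁻¹ * h) • dP (X i)) := by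
    rw [← hlin, ← hom_lieExp_eq_exp _ (hd _), hexp _ hh]
  change P h = P g * NormedSpace.exp (∑ i, x i (g⁻¹ * h) • dP (X i))
  rw [← h5, ← map_mul, mul_inv_cancel_left]

theorem leftDeriv_clm_comp_hom
    (hd : ∀ X g t, HasDerivAt (fun s : ℝ => P (g * lieExp (s • X)))
      (P (g * lieExp (t • X)) * dP X) t)
    {F : Type*} [NormedAddCommGroup F] [NormedSpace ℝ F] (L : R →L[ℝ] F) (g : G)
    (hP : MDifferentiableAt 𝓘(ℝ, E) 𝓘(ℝ, R) P g) (X : GroupLieAlgebra 𝓘(ℝ, E) G) :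
    leftDeriv X (fun h => L (P h)) g = L (P g * dP X) := by
  have h1 : MDifferentiableAt 𝓘(ℝ, E) 𝓘(ℝ, F) (fun h => L (P h)) g :=
    L.differentiableAt.mdifferentiableAt.comp g hP
  have h2 := hasDerivAt_comp_mul_lieExp X (f := fun h => L (P h)) g 0
    (by rwa [lieExp_zero_smul, mul_one])
  have h3 := L.hasFDerivAt.comp_hasDerivAt (0 : ℝ) (hd X g 0)
  rw [lieExp_zero_smul, mul_one] at h2 h3
  exact h2.unique h3

/-- The second derivative of `t ↦ P(exp(tY))` is `P(exp(tY)) (dP Y)²`, and `P` is bounded on the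
compact group; Cauchy–Schwarz bounds `‖dP Y‖²` by the coordinates of `Y`. -/
theorem exists_norm_hom_taylor_le (hP : Continuous P)
    (hd : ∀ X g t, HasDerivAt (fun s : ℝ => P (g * lieExp (s • X)))
      (P (g * lieExp (t • X)) * dP X) t)
    (hlin : ∀ (n : ℕ) (X : Fin n → GroupLieAlgebra 𝓘(ℝ, E) G) (c : Fin n → ℝ),
      dP (∑ i, c i • X i) = ∑ i, c i • dP (X i))
    {n : ℕ} (X : Fin n → GroupLieAlgebra 𝓘(ℝ, E) G) :
    ∃ K : ℝ, 0 ≤ K ∧ ∀ c : Fin n → ℝ,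
      ‖P (lieExp (∑ i, c i • X i)) - 1 - ∑ i, c i • dP (X i)‖ ≤ K * ∑ i, c i ^ 2 := by
  obtain ⟨C, hC⟩ := isCompact_univ.exists_bound_of_continuousOn hP.continuousOn
  have hC0 : 0 ≤ C := (norm_nonneg _).trans (hC 1 (mem_univ 1))
  refine ⟨C * ∑ i, ‖dP (X i)‖ ^ 2, mul_nonneg hC0 (Finset.sum_nonneg fun i _ => sq_nonneg _),
    fun c => ?_⟩
  set Y := ∑ i, c i • X i with hY
  have h1 := hd Y 1
  simp only [one_mul] at h1
  have h2 := norm_taylor_two_le h1 (fun t => (h1 t).mul_const (dP Y))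
    (M := C * ‖dP Y‖ ^ 2) fun t => by
      refine (norm_mul_le _ _).trans ?_
      rw [sq, ← mul_assoc]
      refine mul_le_mul_of_nonneg_right ((norm_mul_le _ _).trans ?_) (norm_nonneg _)
      exact mul_le_mul_of_nonneg_right (hC _ (mem_univ _)) (norm_nonneg _)
  simp only [one_smul, lieExp_zero_smul, map_one, one_mul] at h2
  rw [← hlin]
  refine h2.trans ?_
  rw [mul_assoc]
  refine mul_le_mul_of_nonneg_left ?_ hC0
  have h3 : ‖dP Y‖ ≤ ∑ i, ‖dP (X i)‖ * |c i| := by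
    rw [hY, hlin]
    refine (norm_sum_le _ _).trans_eq (Finset.sum_congr rfl fun i _ => ?_)
    rw [norm_smul, Real.norm_eq_abs, mul_comm]
  calc ‖dP Y‖ ^ 2 ≤ (∑ i, ‖dP (X i)‖ * |c i|) ^ 2 := by gcongr
    _ ≤ (∑ i, ‖dP (X i)‖ ^ 2) * ∑ i, |c i| ^ 2 := Finset.sum_mul_sq_le_sq_mul_sq _ _ _
    _ = _ := by simp only [sq_abs]

end Hom

/-! ### Matrix representations -/

section Rep

variable {E : Type*} [NormedAddCommGroup E] [NormedSpace ℝ E] [FiniteDimensional ℝ E]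
  {G : Type*} [TopologicalSpace G] [ChartedSpace E G] [Group G] [LieGroup 𝓘(ℝ, E) ∞ G]
  [T2Space G] [CompactSpace G] [MeasurableSpace G] [BorelSpace G]

theorem UnitaryIrrep.mat_mul (π : UnitaryIrrep G) (g h : G) :
    π.mat (g * h) = π.mat g * π.mat h := by
  simp [UnitaryIrrep.mat]

/-- The matrix entry as a real-linear functional. -/
def matrixEntry {d : ℕ} (i j : Fin d) : Matrix (Fin d) (Fin d) ℂ →ₗ[ℝ] ℂ where
  toFun A := A i j
  map_add' _ _ := rfl
  map_smul' _ _ := rfl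

open scoped Matrix.Norms.Operator in
theorem norm_entry_le_linfty_opNorm {d : ℕ} (A : Matrix (Fin d) (Fin d) ℂ) (k l : Fin d) :
    ‖A k l‖ ≤ ‖A‖ := by
  have h : ‖A k l‖₊ ≤ ‖A‖₊ := by
    rw [Matrix.linfty_opNNNorm_def]
    exact (Finset.single_le_sum (f := fun j => ‖A k j‖₊) (fun j _ => zero_le)
      (Finset.mem_univ l)).trans
      (Finset.le_sup (f := fun i => ∑ j, ‖A i j‖₊) (Finset.mem_univ k))
  exact h

-- The Banach algebra results are transferred to matrices, with conclusions stated entrywise so that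
-- no matrix norm appears in them. The right factor `C` serves iteration: `C = 1` gives first
-- derivatives and `C = dπ(X)` second ones.
open scoped Matrix.Norms.Operator in
theorem UnitaryIrrep.smoothness_and_taylor_bound (m : Measure G) [m.IsMulRightInvariant] [IsProbabilityMeasure m]
    (π : UnitaryIrrep G) {n : ℕ} {X : Fin n → GroupLieAlgebra 𝓘(ℝ, E) G} {U : Set G}
    {x : Fin n → G → ℝ} (hx : ∀ i, ContMDiff 𝓘(ℝ, E) 𝓘(ℝ, ℝ) ∞ (x i))
    (hU : IsCanonicalCoord X U x) :
    (∀ (Y : GroupLieAlgebra 𝓘(ℝ, E) G) (C : Matrix (Fin π.dim) (Fin π.dim) ℂ) (i j : Fin π.dim)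
      (g : G) (t : ℝ), HasDerivAt (fun s : ℝ => (π.mat (g * lieExp (s • Y)) * C) i j)
        ((π.mat (g * lieExp (t • Y)) * (π.deriv Y * C)) i j) t) ∧
    (∀ (Y : GroupLieAlgebra 𝓘(ℝ, E) G) (C : Matrix (Fin π.dim) (Fin π.dim) ℂ) (i j : Fin π.dim)
      (g : G), leftDeriv Y (fun h => (π.mat h * C) i j) g = (π.mat g * (π.deriv Y * C)) i j) ∧
    ∃ K : ℝ, 0 ≤ K ∧ ∀ τ ∈ U, ∀ k l : Fin π.dim,
      ‖(π.mat τ - 1 - ∑ i, (x i τ : ℂ) • π.deriv (X i)) k l‖ ≤ K * ∑ i, x i τ ^ 2 := by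
  let P : G →* Matrix (Fin π.dim) (Fin π.dim) ℂ :=
    (Matrix.unitaryGroup (Fin π.dim) ℂ).subtype.comp π.toHom
  have hP : Continuous P := π.continuous_mat
  have hPm : ∀ g, P g = π.mat g := fun _ => rfl
  obtain ⟨dP, hd, hlin⟩ := exists_hasDerivAt_hom (E := E) m hP
  let L : Fin π.dim → Fin π.dim → Matrix (Fin π.dim) (Fin π.dim) ℂ →L[ℝ] ℂ := fun i j =>
    LinearMap.toContinuousLinearMap (matrixEntry i j)
  let mulR : Matrix (Fin π.dim) (Fin π.dim) ℂ →
      Matrix (Fin π.dim) (Fin π.dim) ℂ →L[ℝ] Matrix (Fin π.dim) (Fin π.dim) ℂ := fun C =>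
    LinearMap.toContinuousLinearMap (LinearMap.mulRight ℝ C)
  have hdP : ∀ Y, π.deriv Y = dP Y := by
    intro Y
    ext i j
    have h1 := ((L i j).hasFDerivAt.comp_hasDerivAt (0 : ℝ) (hd Y 1 0)).deriv
    simp only [one_mul, lieExp_zero_smul, map_one] at h1
    exact h1
  refine ⟨fun Y C i j g t => ?_, fun Y C i j g => ?_, ?_⟩
  · have h1 := ((L i j).comp (mulR C)).hasFDerivAt.comp_hasDerivAt t (hd Y g t)
    rw [hdP, ← mul_assoc]
    exact h1
  · have h1 := leftDeriv_clm_comp_hom hd ((L i j).comp (mulR C)) g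
      (mdifferentiableAt_hom hd hlin hx hU g) Y
    rw [hdP, ← mul_assoc]
    exact h1
  · obtain ⟨K, hK, h⟩ := exists_norm_hom_taylor_le hP hd hlin X
    obtain ⟨-, -, V, -, -, -, -, -, hexp⟩ := hU
    refine ⟨K, hK, fun τ hτ k l => ?_⟩
    have h1 := h fun i => x i τ
    rw [hexp τ hτ, hPm] at h1
    have h2 : π.mat τ - 1 - ∑ i, (x i τ : ℂ) • π.deriv (X i)
        = π.mat τ - 1 - ∑ i, x i τ • dP (X i) := by
      simp only [hdP, Complex.coe_smul]
    rw [h2]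
    exact (norm_entry_le_linfty_opNorm _ k l).trans h1

end Rep

/-! ### Weighted integral inequalities -/

section Weighted

variable {α β : Type*} [MeasurableSpace α] [MeasurableSpace β]

/-- Dividing the finite measure `w μ` by `w` returns `μ`. This makes Tonelli available for possibly
infinite Lévy measures. -/
theorem sFinite_of_lintegral_ne_top {μ : Measure β} {w : β → ℝ≥0∞} (hw : Measurable w)
    (h0 : ∀ᵐ x ∂μ, w x ≠ 0) (hi : ∫⁻ x, w x ∂μ ≠ ⊤) : SFinite μ := by
  have : IsFiniteMeasure (μ.withDensity w) := isFiniteMeasure_withDensity hi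
  rw [← withDensity_inv_same hw h0 ((ae_lt_top hw hi).mono fun x hx => hx.ne)]
  infer_instance

/-- Cauchy–Schwarz for the factorisation `k = w^{1/2} · (k w^{-1/2})`. -/
theorem sq_lintegral_le {μ : Measure β} {w k : β → ℝ≥0∞} (hw : Measurable w) (hk : Measurable k)
    (h0 : ∀ᵐ x ∂μ, w x ≠ 0) (ht : ∀ᵐ x ∂μ, w x ≠ ⊤) :
    (∫⁻ x, k x ∂μ) ^ 2 ≤ (∫⁻ x, w x ∂μ) * ∫⁻ x, k x ^ 2 * (w x)⁻¹ ∂μ := by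
  have h := ENNReal.lintegral_mul_le_Lp_mul_Lq μ Real.HolderConjugate.two_two
    (f := fun x => w x ^ (1 / 2 : ℝ)) (g := fun x => k x * (w x)⁻¹ ^ (1 / 2 : ℝ))
    (hw.pow_const _).aemeasurable (hk.mul (hw.inv.pow_const _)).aemeasurable
  have e1 : ∫⁻ x, ((fun x => w x ^ (1 / 2 : ℝ)) * fun x => k x * (w x)⁻¹ ^ (1 / 2 : ℝ)) x ∂μ
      = ∫⁻ x, k x ∂μ := by
    refine lintegral_congr_ae ?_
    filter_upwards [h0, ht] with x hx0 hxt
    simp only [Pi.mul_apply]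
    rw [mul_left_comm, ← ENNReal.mul_rpow_of_nonneg _ _ (by norm_num),
      ENNReal.mul_inv_cancel hx0 hxt, ENNReal.one_rpow, mul_one]
  have e2 : ∀ y : ℝ≥0∞, (y ^ (1 / 2 : ℝ)) ^ (2 : ℝ) = y := fun y => by
    rw [← ENNReal.rpow_mul]
    norm_num
  rw [e1] at h
  have h2 := pow_le_pow_left' h 2
  rw [mul_pow, ← ENNReal.rpow_natCast, ← ENNReal.rpow_natCast, ← ENNReal.rpow_natCast] at h2
  simp only [Nat.cast_ofNat, e2] at h2
  rw [ENNReal.rpow_ofNat] at h2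
  refine h2.trans_eq ?_
  congr 1
  refine lintegral_congr fun x => ?_
  rw [ENNReal.mul_rpow_of_nonneg _ _ (by norm_num), e2, ENNReal.rpow_ofNat]

/-- A weighted form of Minkowski's integral inequality in `L²`. -/
theorem lintegral_sq_lintegral_le {m : Measure α} [SFinite m] {μ : Measure β} [SFinite μ]
    {w : β → ℝ≥0∞} {k : α → β → ℝ≥0∞} {C : ℝ≥0∞} (hw : Measurable w)
    (hk : Measurable (Function.uncurry k)) (h0 : ∀ᵐ x ∂μ, w x ≠ 0) (ht : ∀ᵐ x ∂μ, w x ≠ ⊤)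
    (hC : ∀ y, ∫⁻ x, k x y ^ 2 ∂m ≤ C * w y ^ 2) :
    ∫⁻ x, (∫⁻ y, k x y ∂μ) ^ 2 ∂m ≤ C * (∫⁻ y, w y ∂μ) ^ 2 := by
  have hm : Measurable (Function.uncurry fun x y => k x y ^ 2 * (w y)⁻¹) :=
    (hk.pow_const 2).mul (hw.inv.comp measurable_snd)
  calc ∫⁻ x, (∫⁻ y, k x y ∂μ) ^ 2 ∂m
      ≤ ∫⁻ x, (∫⁻ y, w y ∂μ) * ∫⁻ y, k x y ^ 2 * (w y)⁻¹ ∂μ ∂m :=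
        lintegral_mono fun x => sq_lintegral_le hw (hk.comp measurable_prodMk_left) h0 ht
    _ = (∫⁻ y, w y ∂μ) * ∫⁻ y, ∫⁻ x, k x y ^ 2 * (w y)⁻¹ ∂m ∂μ := by
        rw [lintegral_const_mul _ hm.lintegral_prod_right,
          lintegral_lintegral_swap hm.aemeasurable]
    -- The bound `C w²` on the inner integral loses one power of `w` to the factor `w⁻¹`.
    _ ≤ (∫⁻ y, w y ∂μ) * ∫⁻ y, C * w y ∂μ := by
        refine mul_le_mul_right (lintegral_mono_ae ?_) _
        filter_upwards [h0, ht] with y hy0 hyt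
        have hky : Measurable fun x => k x y ^ 2 :=
          (hk.comp measurable_prodMk_right).pow_const 2
        rw [lintegral_mul_const _ hky]
        refine (mul_le_mul_left (hC y) _).trans_eq ?_
        rw [sq, mul_assoc, mul_assoc, ENNReal.mul_inv_cancel hy0 hyt, mul_one]
    _ = C * (∫⁻ y, w y ∂μ) ^ 2 := by
        rw [lintegral_const_mul _ hw, sq]
        ring

theorem sq_eLpNorm_two {V : Type*} [NormedAddCommGroup V] {m : Measure α} (f : α → V) :
    eLpNorm f 2 m ^ 2 = ∫⁻ x, ‖f x‖ₑ ^ 2 ∂m := by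
  have := eLpNorm_nnreal_pow_eq_lintegral (f := f) (μ := m) (p := 2) two_ne_zero
  simpa using this

end Weighted

/-! ### The Lévy kernel -/

namespace Characteristics

variable {E : Type*} [NormedAddCommGroup E] [NormedSpace ℝ E] [FiniteDimensional ℝ E]
  {G : Type*} [TopologicalSpace G] [ChartedSpace E G] [Group G] [LieGroup 𝓘(ℝ, E) ∞ G]
  [T2Space G] [CompactSpace G] [MeasurableSpace G] [BorelSpace G]
  {n : ℕ} (χ : Characteristics E G n)

/-- The weight `min (∑ xᵢ²) 1 + 1_{Uᶜ}`, integrable for all Lévy measures. -/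
def weight (τ : G) : ℝ≥0∞ :=
  ENNReal.ofReal (min (∑ i, χ.x i τ ^ 2) 1) + χ.Uᶜ.indicator 1 τ

theorem measurableSet_U : MeasurableSet χ.U := χ.isCanonicalCoord.1.measurableSet

theorem continuous_x (i : Fin n) : Continuous (χ.x i) := (χ.contMDiff_x i).continuous

theorem measurable_weight : Measurable χ.weight := by
  refine Measurable.add ?_ ((measurable_const (a := (1 : ℝ≥0∞))).indicator χ.measurableSet_U.compl)
  have : Continuous fun τ => min (∑ i, χ.x i τ ^ 2) 1 :=
    (continuous_finsetSum _ fun i _ => (χ.continuous_x i).pow 2).min continuous_const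
  exact this.measurable.ennreal_ofReal

theorem weight_ne_top (τ : G) : χ.weight τ ≠ ⊤ := by
  refine ENNReal.add_ne_top.2 ⟨ENNReal.ofReal_ne_top, ?_⟩
  by_cases h : τ ∈ χ.Uᶜ <;> simp [h]

theorem one_le_weight {τ : G} (hτ : τ ∉ χ.U) : 1 ≤ χ.weight τ := by
  rw [weight, indicator_of_mem (by exact hτ)]
  exact le_add_self

/-- Inside `U` canonical coordinates vanish only at the identity, and outside `U` the weight is at
least `1`. Since Lévy measures do not charge the identity, one may divide by the weight. -/
theorem weight_ne_zero {τ : G} (hτ : τ ≠ 1) : χ.weight τ ≠ 0 := by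
  intro h0
  by_cases hU : τ ∈ χ.U
  · rw [weight, add_eq_zero, ENNReal.ofReal_eq_zero] at h0
    have h1 : ∑ i, χ.x i τ ^ 2 ≤ 0 := by
      rcases min_le_iff.1 h0.1 with h | h
      · exact h
      · norm_num at h
    have h2 : ∀ i, χ.x i τ = 0 := fun i => by
      have := (Finset.sum_eq_zero_iff_of_nonneg fun i _ => sq_nonneg (χ.x i τ)).1
        (h1.antisymm (Finset.sum_nonneg fun i _ => sq_nonneg _)) i (Finset.mem_univ i)
      exact pow_eq_zero_iff two_ne_zero |>.1 this
    obtain ⟨-, -, V, -, -, -, -, -, hexp⟩ := χ.isCanonicalCoord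
    have h3 := hexp τ hU
    simp only [h2, zero_smul, Finset.sum_const_zero, lieExp_zero] at h3
    exact hτ h3.symm
  · have := χ.one_le_weight hU
    rw [h0] at this
    simp at this

/-- By compactness the coordinates are bounded, so truncation at `1` costs only a constant. -/
theorem exists_sum_sq_le_weight :
    ∃ B : ℝ≥0, ∀ τ, ENNReal.ofReal (∑ i, χ.x i τ ^ 2) ≤ B * χ.weight τ := by
  have hc : Continuous fun τ => ∑ i, χ.x i τ ^ 2 :=
    continuous_finsetSum _ fun i _ => (χ.continuous_x i).pow 2
  obtain ⟨B, hB⟩ := isCompact_univ.exists_bound_of_continuousOn hc.continuousOn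
  refine ⟨(max B 1).toNNReal, fun τ => ?_⟩
  have h1 : ∑ i, χ.x i τ ^ 2 ≤ max B 1 * min (∑ i, χ.x i τ ^ 2) 1 := by
    have h2 : ∑ i, χ.x i τ ^ 2 ≤ B := (le_abs_self _).trans (hB τ (mem_univ τ))
    have h3 : 0 ≤ ∑ i, χ.x i τ ^ 2 := Finset.sum_nonneg fun i _ => sq_nonneg _
    rcases le_total (∑ i, χ.x i τ ^ 2) 1 with h | h
    · rw [min_eq_left h]
      exact le_mul_of_one_le_left h3 (le_max_right _ _)
    · rw [min_eq_right h, mul_one]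
      exact h2.trans (le_max_left _ _)
  calc _ ≤ ENNReal.ofReal (max B 1 * min (∑ i, χ.x i τ ^ 2) 1) := ENNReal.ofReal_le_ofReal h1
    _ = ENNReal.ofReal (max B 1) * ENNReal.ofReal (min (∑ i, χ.x i τ ^ 2) 1) :=
        ENNReal.ofReal_mul (zero_le_one.trans (le_max_right _ _))
    _ ≤ _ := mul_le_mul_right le_self_add _

/-- On `U` the supremum of the densities is attained at `g'`, so the shifted measure at `g'`
dominates there; off `U` the uniform density bound gives a multiple of `ρ`. A dominating measure
independent of `g` is what permits Fubini arguments in `(g, τ)`. -/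
theorem exists_dominating : ∃ μ : Measure G, (∀ g, shifted χ.ν g ≤ μ) ∧
    ∫⁻ τ, χ.weight τ ∂μ ≠ ⊤ ∧ μ {1} = 0 := by
  obtain ⟨g', hg'⟩ := χ.lam_attained
  obtain ⟨C, hC⟩ := χ.lam_bounded
  have hU := χ.measurableSet_U
  refine ⟨(shifted χ.ν g').restrict χ.U + C • χ.ρ.restrict χ.Uᶜ, fun g => ?_, ?_, ?_⟩
  · rw [← Measure.restrict_add_restrict_compl (μ := shifted χ.ν g) hU]
    refine add_le_add ?_ ?_
    · rw [χ.shifted_ν_eq, χ.shifted_ν_eq, restrict_withDensity hU, restrict_withDensity hU]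
      refine withDensity_mono ((ae_restrict_iff' hU).2 (Eventually.of_forall fun τ hτ => ?_))
      rw [hg' τ hτ]
      exact le_iSup (fun g => χ.lam g τ) g
    · rw [χ.shifted_ν_eq, restrict_withDensity hU.compl]
      refine (withDensity_mono (g := fun _ => (C : ℝ≥0∞))
        ((ae_restrict_iff' hU.compl).2 (Eventually.of_forall fun τ hτ => hC τ hτ g))).trans ?_
      rw [withDensity_const]
      rfl
  · obtain ⟨C', hC'⟩ := χ.levy_ν
    rw [lintegral_add_measure, ENNReal.add_ne_top]
    constructor
    · have h1 : ∫⁻ τ in χ.U, χ.weight τ ∂(shifted χ.ν g')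
          = ∫⁻ τ in χ.U, ENNReal.ofReal (min (∑ i, χ.x i τ ^ 2) 1) ∂(shifted χ.ν g') :=
        setLIntegral_congr_fun hU fun τ hτ => by simp [weight, hτ]
      rw [h1]
      exact ((setLIntegral_le_lintegral _ _).trans (hC' g')).trans_lt ENNReal.coe_lt_top |>.ne
    · rw [lintegral_smul_measure]
      refine ENNReal.mul_ne_top ENNReal.coe_ne_top (ne_of_lt ?_)
      have h2 : ∫⁻ τ in χ.Uᶜ, χ.weight τ ∂χ.ρ ≤ ∫⁻ _ in χ.Uᶜ, 2 ∂χ.ρ := by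
        refine lintegral_mono fun τ => ?_
        have h3 : ENNReal.ofReal (min (∑ i, χ.x i τ ^ 2) 1) ≤ 1 :=
          ENNReal.ofReal_le_one.2 (min_le_right _ _)
        exact (add_le_add h3 (indicator_le_self _ (1 : G → ℝ≥0∞) τ)).trans_eq one_add_one_eq_two
      refine h2.trans_lt ?_
      rw [setLIntegral_const]
      exact ENNReal.mul_lt_top (by simp) χ.levy_ρ_compl
  · have h1 : (shifted χ.ν g') {1} = 0 := by
      rw [χ.shifted_ν_eq]
      exact withDensity_absolutelyContinuous _ _ χ.ρ_one
    have h2 : (shifted χ.ν g').restrict χ.U {1} = 0 :=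
      le_antisymm ((Measure.restrict_apply_le _ _).trans h1.le) zero_le
    have h3 : χ.ρ.restrict χ.Uᶜ {1} = 0 :=
      le_antisymm ((Measure.restrict_apply_le _ _).trans χ.ρ_one.le) zero_le
    rw [Measure.add_apply, Measure.smul_apply, h2, h3, smul_zero, add_zero]

theorem ae_weight_ne_zero {μ : Measure G} (h : μ {1} = 0) : ∀ᵐ τ ∂μ, χ.weight τ ≠ 0 := by
  have : ∀ᵐ τ ∂μ, τ ≠ 1 := measure_eq_zero_iff_ae_notMem.1 h
  exact this.mono fun τ hτ => χ.weight_ne_zero hτ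

theorem shifted_one (g : G) : shifted χ.ν g {1} = 0 := by
  rw [χ.shifted_ν_eq]
  exact withDensity_absolutelyContinuous _ _ χ.ρ_one

theorem integrable_shifted_of_le {f : G → ℂ} (hf : Measurable f) {C : ℝ≥0∞} (hC : C ≠ ⊤)
    (h : ∀ τ, ‖f τ‖ₑ ≤ C * χ.weight τ) (g : G) : Integrable f (shifted χ.ν g) := by
  obtain ⟨μ, hμ, hi, -⟩ := χ.exists_dominating
  refine ⟨hf.aestronglyMeasurable, ?_⟩
  calc ∫⁻ τ, ‖f τ‖ₑ ∂(shifted χ.ν g) ≤ ∫⁻ τ, C * χ.weight τ ∂μ := lintegral_mono' (hμ g) h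
    _ < ⊤ := by
      rw [lintegral_const_mul _ χ.measurable_weight]
      exact ENNReal.mul_lt_top hC.lt_top hi.lt_top

/-- The shifted Lévy kernel, as a kernel. -/
def shiftedKernel : ProbabilityTheory.Kernel G G where
  toFun := shifted χ.ν
  measurable' := Measure.measurable_of_measurable_coe _ χ.measurable_ν

/-- The shifted Lévy kernel multiplied by the weight; a finite kernel. -/
def weightedKernel : ProbabilityTheory.Kernel G G where
  toFun g := (shifted χ.ν g).withDensity χ.weight
  measurable' := by
    refine Measure.measurable_of_measurable_coe _ fun B hB => ?_
    simp only [withDensity_apply _ hB, ← lintegral_indicator hB]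
    exact Measurable.lintegral_kernel (κ := χ.shiftedKernel) (χ.measurable_weight.indicator hB)

instance : ProbabilityTheory.IsFiniteKernel χ.weightedKernel := by
  obtain ⟨μ, hμ, hi, -⟩ := χ.exists_dominating
  refine ⟨⟨∫⁻ τ, χ.weight τ ∂μ, hi.lt_top, fun g => ?_⟩⟩
  change (shifted χ.ν g).withDensity χ.weight univ ≤ _
  rw [withDensity_apply _ MeasurableSet.univ, Measure.restrict_univ]
  exact lintegral_mono' (hμ g) le_rfl

/-- The weight is absorbed into the kernel, making it finite, and divided out of the integrand;
measurability of parameter integrals then applies to an integrand that also depends on `g`. -/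
theorem stronglyMeasurable_integral_shifted {h : G → G → ℂ}
    (hh : StronglyMeasurable (Function.uncurry h)) :
    StronglyMeasurable fun g => ∫ τ, h g τ ∂(shifted χ.ν g) := by
  have e : ∀ g, ∫ τ, h g τ ∂(shifted χ.ν g)
      = ∫ τ, (χ.weight τ)⁻¹.toReal • h g τ ∂(χ.weightedKernel g) := by
    intro g
    change _ = ∫ τ, (χ.weight τ)⁻¹.toReal • h g τ ∂((shifted χ.ν g).withDensity χ.weight)
    rw [integral_withDensity_eq_integral_toReal_smul χ.measurable_weight
      (Eventually.of_forall fun τ => (χ.weight_ne_top τ).lt_top)]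
    refine integral_congr_ae ?_
    filter_upwards [χ.ae_weight_ne_zero (χ.shifted_one g)] with τ hτ
    rw [smul_smul, ← ENNReal.toReal_mul, ENNReal.mul_inv_cancel hτ (χ.weight_ne_top τ),
      ENNReal.toReal_one, one_smul]
  simp only [e]
  refine StronglyMeasurable.integral_kernel_prod_right ?_
  have h1 : Measurable fun p : G × G => (χ.weight p.2)⁻¹.toReal :=
    (χ.measurable_weight.comp measurable_snd).inv.ennreal_toReal
  exact h1.stronglyMeasurable.smul hh

end Characteristics

namespace Characteristics

variable {E : Type*} [NormedAddCommGroup E] [NormedSpace ℝ E] [FiniteDimensional ℝ E]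
  {G : Type*} [TopologicalSpace G] [ChartedSpace E G] [Group G] [LieGroup 𝓘(ℝ, E) ∞ G]
  [T2Space G] [CompactSpace G] [MeasurableSpace G] [BorelSpace G]
  [IsTopologicalGroup G] [SecondCountableTopology G]
  {m : Measure G} [m.IsMulRightInvariant] [IsProbabilityMeasure m]
  {n : ℕ} (χ : Characteristics E G n)

/-! ### The jump part -/

/-- The integrand `F(gτ) - F(g) - xⁱ(τ) Dᵢ(g)`. -/
def shiftedJump (F : G → ℂ) (D : Fin n → G → ℂ) (g τ : G) : ℂ :=
  F (g * τ) - F g - ∑ i, χ.x i τ • D i g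

theorem jump_eq_comp (F : G → ℂ) (D : Fin n → G → ℂ) (g : G) :
    χ.jump F D g = χ.shiftedJump F D g ∘ fun τ => g⁻¹ * τ := by
  funext τ
  simp [jump, shiftedJump]

theorem measurableEmbedding_inv_mul (g : G) : MeasurableEmbedding fun τ : G => g⁻¹ * τ :=
  measurableEmbedding_mulLeft g⁻¹

theorem integrable_comp_inv_mul_iff {f : G → ℂ} (g : G) :
    Integrable (fun τ => f (g⁻¹ * τ)) (χ.ν g) ↔ Integrable f (shifted χ.ν g) :=
  (measurableEmbedding_inv_mul g).integrable_map_iff.symm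

theorem integral_comp_inv_mul (f : G → ℂ) (g : G) :
    ∫ τ, f (g⁻¹ * τ) ∂(χ.ν g) = ∫ τ, f τ ∂(shifted χ.ν g) :=
  ((measurableEmbedding_inv_mul g).integral_map f).symm

theorem measurable_shiftedJump {F : G → ℂ} {D : Fin n → G → ℂ} (hF : Measurable F)
    (hD : ∀ i, Measurable (D i)) : Measurable (Function.uncurry (χ.shiftedJump F D)) := by
  refine ((hF.comp measurable_mul).sub (hF.comp measurable_fst)).sub
    (Finset.measurable_sum _ fun i _ => ?_)
  exact ((χ.continuous_x i).measurable.comp measurable_snd).smul ((hD i).comp measurable_fst)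

/-- On `U`, where `τ = exp(∑ xᵢ(τ)Xᵢ)`, this is the `L²` Taylor estimate. Off `U` the triangle
inequality, translation invariance and boundedness of the coordinates suffice, as the weight is at
least `1`. -/
theorem exists_eLpNorm_shiftedJump_le {F : G → ℂ} {D : Fin n → G → ℂ}
    {D₂ : Fin n → Fin n → G → ℂ} (H : IsSobolevTwo m χ.X F D D₂) :
    ∃ C : ℝ≥0, ∀ τ, eLpNorm (fun g => χ.shiftedJump F D g τ) 2 m ≤ C * χ.weight τ := by
  obtain ⟨B, hB⟩ := χ.exists_sum_sq_le_weight
  obtain ⟨C, hC0, hC⟩ := H.eLpNorm_taylor_le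
  obtain ⟨-, -, V, -, -, -, -, -, hexp⟩ := χ.isCanonicalCoord
  have hb : ∀ i, ∃ b : ℝ, ∀ τ, ‖χ.x i τ‖ ≤ b := fun i => by
    obtain ⟨b, hb⟩ := isCompact_univ.exists_bound_of_continuousOn (χ.continuous_x i).continuousOn
    exact ⟨b, fun τ => hb τ (mem_univ τ)⟩
  choose b hb using hb
  set K : ℝ≥0∞ := eLpNorm F 2 m + eLpNorm F 2 m
    + ∑ i, ENNReal.ofReal (b i) * eLpNorm (D i) 2 m with hK
  have hKt : K ≠ ⊤ := by
    refine ENNReal.add_ne_top.2 ⟨ENNReal.add_ne_top.2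
      ⟨H.memLp.eLpNorm_ne_top, H.memLp.eLpNorm_ne_top⟩, ENNReal.sum_ne_top.2 fun i _ => ?_⟩
    exact ENNReal.mul_ne_top ENNReal.ofReal_ne_top (H.memLp_first i).eLpNorm_ne_top
  refine ⟨C.toNNReal * B + K.toNNReal, fun τ => ?_⟩
  rw [ENNReal.coe_add, add_mul, ENNReal.coe_toNNReal hKt]
  by_cases hτ : τ ∈ χ.U
  · refine le_trans ?_ le_self_add
    have h1 := hC fun i => χ.x i τ
    rw [hexp τ hτ] at h1
    refine h1.trans ?_
    rw [ENNReal.ofReal_mul hC0, ENNReal.coe_mul, mul_assoc]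
    exact mul_le_mul_right (hB τ) _
  · refine le_trans ?_ le_add_self
    refine le_trans ?_ (le_mul_of_one_le_right' (χ.one_le_weight hτ))
    have mp := measurePreserving_mul_right m τ
    have hFτ : MemLp (fun g => F (g * τ)) 2 m := H.memLp.comp_measurePreserving mp
    have e : eLpNorm (fun g => F (g * τ)) 2 m = eLpNorm F 2 m :=
      eLpNorm_comp_measurePreserving H.memLp.1 mp
    have hS := memLp_sum_smul H.memLp_first fun i => χ.x i τ
    refine (eLpNorm_sub_le (hFτ.sub H.memLp).1 hS.1 one_le_two).trans (add_le_add ?_ ?_)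
    · refine (eLpNorm_sub_le hFτ.1 H.memLp.1 one_le_two).trans_eq ?_
      rw [e]
    · refine (eLpNorm_sum_smul_le H.memLp_first _).trans (Finset.sum_le_sum fun i _ => ?_)
      refine mul_le_mul_left ?_ _
      rw [← ofReal_norm]
      exact ENNReal.ofReal_le_ofReal (hb i τ)

theorem lintegral_sq_shiftedJump {F : G → ℂ} {D : Fin n → G → ℂ}
    {D₂ : Fin n → Fin n → G → ℂ} (H : IsSobolevTwo m χ.X F D D₂) (hF : Measurable F)
    (hD : ∀ i, Measurable (D i)) {μ : Measure G} (hμ : ∫⁻ τ, χ.weight τ ∂μ ≠ ⊤)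
    (hμ1 : μ {1} = 0) :
    ∫⁻ g, (∫⁻ τ, ‖χ.shiftedJump F D g τ‖ₑ ∂μ) ^ 2 ∂m ≠ ⊤ := by
  obtain ⟨C, hC⟩ := χ.exists_eLpNorm_shiftedJump_le H
  have h0 := χ.ae_weight_ne_zero hμ1
  have : SFinite μ := sFinite_of_lintegral_ne_top χ.measurable_weight h0 hμ
  refine ((lintegral_sq_lintegral_le (C := C ^ 2) χ.measurable_weight
    (χ.measurable_shiftedJump hF hD).enorm h0
    (Eventually.of_forall χ.weight_ne_top) fun τ => ?_).trans_lt ?_).ne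
  · rw [← sq_eLpNorm_two, ← mul_pow]
    exact pow_le_pow_left' (hC τ) 2
  · exact ENNReal.mul_lt_top (ENNReal.pow_lt_top ENNReal.coe_lt_top) (ENNReal.pow_lt_top hμ.lt_top)

/-- For `f` in the Sobolev space, the integral in the Courrège–Hunt formula converges absolutely
almost everywhere, and the formula defines a square integrable function. -/
theorem ae_integrable_jump_and_memLp_expr {F : G → ℂ} {D : Fin n → G → ℂ}
    {D₂ : Fin n → Fin n → G → ℂ} (H : IsSobolevTwo m χ.X F D D₂) (hF : Measurable F)
    (hD : ∀ i, Measurable (D i)) :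
    (∀ᵐ g ∂m, Integrable (χ.jump F D g) (χ.ν g)) ∧ MemLp (χ.expr F D D₂) 2 m := by
  obtain ⟨μ, hμ, hμt, hμ1⟩ := χ.exists_dominating
  have : SFinite μ := sFinite_of_lintegral_ne_top χ.measurable_weight
    (χ.ae_weight_ne_zero hμ1) hμt
  have hK := χ.measurable_shiftedJump hF hD
  have hfin := χ.lintegral_sq_shiftedJump H hF hD hμt hμ1
  have hKm : Measurable fun g => (∫⁻ τ, ‖χ.shiftedJump F D g τ‖ₑ ∂μ) ^ 2 :=
    (Measurable.lintegral_prod_right hK.enorm).pow_const 2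
  constructor
  -- A finite `L²` norm forces the dominating integral to be finite for almost every `g`.
  · filter_upwards [ae_lt_top hKm hfin] with g hg
    rw [jump_eq_comp]
    refine (χ.integrable_comp_inv_mul_iff g).2
      ⟨(hK.comp measurable_prodMk_left).aestronglyMeasurable, ?_⟩
    exact (lintegral_mono' (hμ g) le_rfl).trans_lt ((ENNReal.pow_lt_top_iff.1 hg).resolve_right
      (by norm_num))
  · have h1 : MemLp (fun g => ∫ τ, χ.jump F D g τ ∂(χ.ν g)) 2 m := by
      have e : (fun g => ∫ τ, χ.jump F D g τ ∂(χ.ν g))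
          = fun g => ∫ τ, χ.shiftedJump F D g τ ∂(shifted χ.ν g) := by
        funext g
        rw [jump_eq_comp]
        exact χ.integral_comp_inv_mul _ g
      rw [e]
      refine ⟨(χ.stronglyMeasurable_integral_shifted hK.stronglyMeasurable).aestronglyMeasurable,
        ?_⟩
      have h2 : eLpNorm (fun g => ∫ τ, χ.shiftedJump F D g τ ∂(shifted χ.ν g)) 2 m ^ 2 < ⊤ := by
        rw [sq_eLpNorm_two]
        refine (lintegral_mono fun g => ?_).trans_lt hfin.lt_top
        exact pow_le_pow_left' ((enorm_integral_le_lintegral_enorm _).trans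
          (lintegral_mono' (hμ g) le_rfl)) 2
      exact (ENNReal.pow_lt_top_iff.1 h2).resolve_right (by norm_num)
    obtain ⟨Cb, hCb⟩ := χ.bounded_b
    obtain ⟨Ca, hCa⟩ := χ.bounded_a
    have h2 : MemLp (fun g => ∑ i, (χ.b i g : ℂ) * D i g) 2 m := by
      refine memLp_finsetSum _ fun i _ => (H.memLp_first i).of_le_mul (c := Cb)
        ((Complex.measurable_ofReal.comp (χ.measurable_b i)).aestronglyMeasurable.mul
          (H.memLp_first i).1) (Eventually.of_forall fun g => ?_)
      rw [norm_mul, Complex.norm_real]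
      exact mul_le_mul_of_nonneg_right (hCb i g) (norm_nonneg _)
    have h3 : MemLp (fun g => ∑ i, ∑ j, (χ.a g i j : ℂ) * D₂ i j g) 2 m := by
      refine memLp_finsetSum _ fun i _ => memLp_finsetSum _ fun j _ =>
        (H.memLp_second i j).of_le_mul (c := Ca)
        ((Complex.measurable_ofReal.comp (χ.measurable_a i j)).aestronglyMeasurable.mul
          (H.memLp_second i j).1) (Eventually.of_forall fun g => ?_)
      rw [norm_mul, Complex.norm_real]
      exact mul_le_mul_of_nonneg_right (hCa i j g) (norm_nonneg _)
    exact (h2.add h3).add h1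

/-- An individual `ν(g, ·)` may be singular with respect to `m`. However, `{(g, τ) | gτ ∈ N}` is
null for `m.prod μ`, since right translates of an `m`-null set `N` are `m`-null; so almost every
section in `τ` is null. -/
theorem ae_ae_eq_zero {F : G → ℂ} (hF : F =ᵐ[m] 0) : ∀ᵐ g ∂m, F =ᵐ[χ.ν g] 0 := by
  obtain ⟨μ, hμ, hμt, hμ1⟩ := χ.exists_dominating
  have : SFinite μ := sFinite_of_lintegral_ne_top χ.measurable_weight
    (χ.ae_weight_ne_zero hμ1) hμt
  obtain ⟨N, hFN, hN, hN0⟩ := exists_measurable_superset_of_null (show m {g | ¬F g = 0} = 0 from hF)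
  have hS : MeasurableSet ((fun p : G × G => p.1 * p.2) ⁻¹' N) := measurable_mul hN
  have h1 : m.prod μ ((fun p : G × G => p.1 * p.2) ⁻¹' N) = 0 := by
    rw [Measure.prod_apply_symm hS]
    have : ∀ τ, m ((fun g => (g, τ)) ⁻¹' ((fun p : G × G => p.1 * p.2) ⁻¹' N)) = 0 := fun τ =>
      ((measurePreserving_mul_right m τ).measure_preimage hN.nullMeasurableSet).trans hN0
    simp only [this, lintegral_zero]
  rw [Measure.measure_prod_null hS] at h1
  filter_upwards [h1] with g hg
  have h2 : shifted χ.ν g ((fun τ => g * τ) ⁻¹' N) = 0 := le_antisymm ((hμ g _).trans hg.le) zero_le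
  rw [shifted, (measurableEmbedding_inv_mul g).map_apply, ← preimage_comp] at h2
  refine measure_mono_null (fun τ hτ => ?_) h2
  simpa [Function.comp_def] using hFN hτ

/-- The Courrège–Hunt formula does not depend on the choice of representatives. -/
theorem snd_eq_zero_of_mem_graph {p : Lp ℂ 2 m × Lp ℂ 2 m} (hp : p ∈ χ.graph m)
    (h0 : p.1 = 0) : p.2 = 0 := by
  obtain ⟨F, D, D₂, hF, hS, -, hu⟩ := hp
  have hF0 : F =ᵐ[m] 0 := hF.trans (h0 ▸ Lp.coeFn_zero ℂ 2 m)
  have hD0 : ∀ i, D i =ᵐ[m] 0 := fun i =>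
    ae_eq_zero_of_isWeakLeftDeriv (hS.memLp_first i) (hS.first i) hF0
  have hD₂0 : ∀ i j, D₂ i j =ᵐ[m] 0 := fun i j =>
    ae_eq_zero_of_isWeakLeftDeriv (hS.memLp_second i j) (hS.second i j) (hD0 j)
  rw [Lp.eq_zero_iff_ae_eq_zero]
  filter_upwards [hu, hF0, ae_all_iff.2 hD0, ae_all_iff.2 fun i => ae_all_iff.2 (hD₂0 i),
    χ.ae_ae_eq_zero hF0] with g hg hFg hDg hD₂g hFν
  have hI : ∫ τ, χ.jump F D g τ ∂(χ.ν g) = 0 := by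
    refine integral_eq_zero_of_ae ?_
    filter_upwards [hFν] with τ hτ
    simp [jump, hτ, hFg, hDg]
  rw [hg]
  simp [expr, hI, hDg, hD₂g]

theorem operator_graph : (χ.operator m).graph = χ.graph m :=
  Submodule.toLinearPMap_graph_eq _ fun _ hp h0 => χ.snd_eq_zero_of_mem_graph hp h0

theorem mem_graph_of_isSobolevTwo {f : Lp ℂ 2 m} {F : G → ℂ} {D : Fin n → G → ℂ}
    {D₂ : Fin n → Fin n → G → ℂ} (hf : F =ᵐ[m] f) (H : IsSobolevTwo m χ.X F D D₂)
    (hF : Measurable F) (hD : ∀ i, Measurable (D i)) :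
    (f, (χ.ae_integrable_jump_and_memLp_expr H hF hD).2.toLp _) ∈ χ.graph m :=
  ⟨F, D, D₂, hf, H, (χ.ae_integrable_jump_and_memLp_expr H hF hD).1,
    MemLp.coeFn_toLp (χ.ae_integrable_jump_and_memLp_expr H hF hD).2⟩

theorem operator_domain : (χ.operator m).domain = sobolevTwo m χ.X := by
  ext f
  rw [operator, Submodule.toLinearPMap_domain, Submodule.mem_map]
  constructor
  · rintro ⟨⟨f', u⟩, ⟨F, D, D₂, hF, H, -, -⟩, rfl⟩
    exact ⟨D, D₂, H.congr hF⟩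
  · rintro ⟨D, D₂, H⟩
    -- The given weak derivatives are only almost everywhere measurable; the jump estimate requires
    -- measurable representatives of `D i`, while `D₂` may stay as it is.
    have e : ∀ i, (H.memLp_first i).toLp (D i) =ᵐ[m] D i := fun i => MemLp.coeFn_toLp _
    have H' : IsSobolevTwo m χ.X f (fun i => (H.memLp_first i).toLp (D i)) D₂ :=
      { memLp := H.memLp
        memLp_first := fun i => Lp.memLp _
        memLp_second := H.memLp_second
        first := fun i φ hφ => by
          rw [H.first i φ hφ]
          congr 1
          refine integral_congr_ae ?_
          filter_upwards [e i] with g hg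
          rw [hg]
        second := fun i j => (H.second i j).congr (e j).symm }
    exact ⟨_, χ.mem_graph_of_isSobolevTwo (ae_eq_refl _) H' (Lp.stronglyMeasurable f).measurable
      fun i => (Lp.stronglyMeasurable _).measurable, rfl⟩

end Characteristics

namespace Characteristics

variable {E : Type*} [NormedAddCommGroup E] [NormedSpace ℝ E] [FiniteDimensional ℝ E]
  {G : Type*} [TopologicalSpace G] [ChartedSpace E G] [Group G] [LieGroup 𝓘(ℝ, E) ∞ G]
  [T2Space G] [CompactSpace G] [MeasurableSpace G] [BorelSpace G]
  {m : Measure G} [m.IsMulRightInvariant] [IsProbabilityMeasure m]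
  {n : ℕ} (χ : Characteristics E G n)

/-! ### Matrix coefficients -/

theorem continuous_mat_mul (π : UnitaryIrrep G) (C : Matrix (Fin π.dim) (Fin π.dim) ℂ) (i j : Fin π.dim) :
    Continuous fun g => (π.mat g * C) i j :=
  (π.continuous_mat.matrix_mul continuous_const).matrix_elem i j

theorem entry_eq (π : UnitaryIrrep G) (i j : Fin π.dim) :
    ⇑(π.entry i j) = fun g : G => (π.mat g * (1 : Matrix (Fin π.dim) (Fin π.dim) ℂ)) i j := by
  funext g
  rw [π.entry_apply, mul_one]

/-- The measure enters only through the smoothing argument that makes `π` differentiable. -/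
theorem leftDeriv_entry (m : Measure G) [m.IsMulRightInvariant]
    [IsProbabilityMeasure m] (π : UnitaryIrrep G) (k : Fin n) (i j : Fin π.dim) :
    leftDeriv (χ.X k) (π.entry i j) = fun g => (π.mat g * π.deriv (χ.X k)) i j := by
  funext g
  have h := (π.smoothness_and_taylor_bound m χ.contMDiff_x χ.isCanonicalCoord).2.1 (χ.X k) 1 i j g
  rw [mul_one] at h
  rw [entry_eq, h]

theorem leftDeriv_leftDeriv_entry (m : Measure G) [m.IsMulRightInvariant]
    [IsProbabilityMeasure m] (π : UnitaryIrrep G) (k l : Fin n) (i j : Fin π.dim) :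
    leftDeriv (χ.X k) (leftDeriv (χ.X l) (π.entry i j))
      = fun g => (π.mat g * (π.deriv (χ.X k) * π.deriv (χ.X l))) i j := by
  funext g
  rw [χ.leftDeriv_entry m]
  exact (π.smoothness_and_taylor_bound m χ.contMDiff_x χ.isCanonicalCoord).2.1 (χ.X k) (π.deriv (χ.X l)) i j g

theorem isWeakLeftDeriv_mat_mul (χ : Characteristics E G n) (π : UnitaryIrrep G)
    (Y : GroupLieAlgebra 𝓘(ℝ, E) G)
    (C : Matrix (Fin π.dim) (Fin π.dim) ℂ) (i j : Fin π.dim) :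
    IsWeakLeftDeriv m Y (fun g => (π.mat g * C) i j)
      (fun g => (π.mat g * (π.deriv Y * C)) i j) :=
  isWeakLeftDeriv_of_hasDerivAt (X := Y) (continuous_mat_mul π C i j) (continuous_mat_mul π _ i j)
    ((π.smoothness_and_taylor_bound m χ.contMDiff_x χ.isCanonicalCoord).1 Y C i j)

theorem isSobolevTwo_entry (π : UnitaryIrrep G) (i j : Fin π.dim) :
    IsSobolevTwo m χ.X (π.entry i j) (fun k => leftDeriv (χ.X k) (π.entry i j))
      (fun k l => leftDeriv (χ.X k) (leftDeriv (χ.X l) (π.entry i j))) := by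
  have hm : ∀ C : Matrix (Fin π.dim) (Fin π.dim) ℂ, MemLp (fun g => (π.mat g * C) i j) 2 m :=
    fun C => (continuous_mat_mul π C i j).memLp_of_hasCompactSupport
      (HasCompactSupport.of_compactSpace _)
  simp only [χ.leftDeriv_leftDeriv_entry m]
  simp only [χ.leftDeriv_entry m]
  rw [entry_eq]
  refine ⟨hm _, fun k => hm _, fun k l => hm _, fun k => ?_, fun k l => ?_⟩
  · have h := χ.isWeakLeftDeriv_mat_mul π (m := m) (χ.X k) 1 i j
    rwa [mul_one (π.deriv (χ.X k))] at h
  · exact χ.isWeakLeftDeriv_mat_mul π (χ.X k) (π.deriv (χ.X l)) i j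

/-! ### The symbol -/

/-- The integrand of the symbol, transported to the identity. -/
def shiftedSymbolJump (π : UnitaryIrrep G) (τ : G) : Matrix (Fin π.dim) (Fin π.dim) ℂ :=
  π.mat τ - 1 - ∑ i, (χ.x i τ : ℂ) • π.deriv (χ.X i)

theorem continuous_shiftedSymbolJump (π : UnitaryIrrep G) (k l : Fin π.dim) :
    Continuous fun τ => χ.shiftedSymbolJump π τ k l := by
  have h : Continuous (χ.shiftedSymbolJump π) :=
    (π.continuous_mat.sub continuous_const).sub (continuous_finsetSum _ fun i _ =>
      (Complex.continuous_ofReal.comp (χ.continuous_x i)).smul continuous_const)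
  exact h.matrix_elem k l

/-- The quadratic Taylor bound on `U` and plain boundedness off `U` are both controlled by the
weight, for every `g` and not just almost every one. -/
theorem integrable_shiftedSymbolJump (m : Measure G) [m.IsMulRightInvariant]
    [IsProbabilityMeasure m] (π : UnitaryIrrep G) (g : G) (k l : Fin π.dim) :
    Integrable (fun τ => χ.shiftedSymbolJump π τ k l) (shifted χ.ν g) := by
  obtain ⟨B, hB⟩ := χ.exists_sum_sq_le_weight
  obtain ⟨K, hK0, hK⟩ := (π.smoothness_and_taylor_bound m χ.contMDiff_x χ.isCanonicalCoord).2.2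
  have hc := χ.continuous_shiftedSymbolJump π k l
  obtain ⟨C, hC⟩ := isCompact_univ.exists_bound_of_continuousOn hc.continuousOn
  refine χ.integrable_shifted_of_le hc.measurable
    (C := ENNReal.ofReal K * B + ENNReal.ofReal C) (by finiteness) (fun τ => ?_) g
  rw [add_mul, ← ofReal_norm]
  by_cases hτ : τ ∈ χ.U
  · refine le_trans ?_ le_self_add
    refine (ENNReal.ofReal_le_ofReal (hK τ hτ k l)).trans ?_
    rw [ENNReal.ofReal_mul hK0, mul_assoc]
    exact mul_le_mul_right (hB τ) _
  · refine le_trans ?_ le_add_self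
    exact (ENNReal.ofReal_le_ofReal (hC τ (mem_univ τ))).trans
      (le_mul_of_one_le_right' (χ.one_le_weight hτ))

theorem integrable_symbolJump (m : Measure G) [m.IsMulRightInvariant]
    [IsProbabilityMeasure m] (π : UnitaryIrrep G) (g : G) (k l : Fin π.dim) :
    Integrable (fun τ => χ.symbolJump π g τ k l) (χ.ν g) := by
  have : IsTopologicalGroup G := topologicalGroup_of_lieGroup 𝓘(ℝ, E) ∞
  have : SecondCountableTopology G := ChartedSpace.secondCountable_of_sigmaCompact E G
  exact (χ.integrable_comp_inv_mul_iff g).2 (χ.integrable_shiftedSymbolJump m π g k l)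

/-- From `π(τ) = π(g) π(g⁻¹τ)` and `Xπ = π dπ(X)`, all three terms share the left factor `π(g)`. -/
theorem jump_entry (m : Measure G) [m.IsMulRightInvariant]
    [IsProbabilityMeasure m] (π : UnitaryIrrep G) (g τ : G) (i j : Fin π.dim) :
    χ.jump (π.entry i j) (fun k => leftDeriv (χ.X k) (π.entry i j)) g τ
      = (π.mat g * χ.symbolJump π g τ) i j := by
  have h : π.mat τ = π.mat g * π.mat (g⁻¹ * τ) := by rw [← π.mat_mul, mul_inv_cancel_left]
  simp only [χ.leftDeriv_entry m, jump, symbolJump, π.entry_apply, mul_sub, mul_one,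
    Matrix.sub_apply, ← h, Matrix.mul_sum, Matrix.sum_apply, Matrix.mul_smul, Matrix.smul_apply,
    smul_eq_mul]

theorem integrable_jump_entry (m : Measure G) [m.IsMulRightInvariant]
    [IsProbabilityMeasure m] (π : UnitaryIrrep G) (g : G) (i j : Fin π.dim) :
    Integrable (χ.jump (π.entry i j) (fun k => leftDeriv (χ.X k) (π.entry i j)) g) (χ.ν g) := by
  have e : χ.jump (π.entry i j) (fun k => leftDeriv (χ.X k) (π.entry i j)) g
      = fun τ => ∑ l, π.mat g i l * χ.symbolJump π g τ l j := by
    funext τ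
    rw [χ.jump_entry m, Matrix.mul_apply]
  rw [e]
  exact integrable_finsetSum _ fun l _ =>
    (χ.integrable_symbolJump m π g l j).const_mul _

/-- The factor `π(g)` also comes out of the drift and diffusion terms; left-invariant
differentiation multiplies on the right of `π`, giving the order `dπ(Xᵢ) dπ(Xⱼ)`. -/
theorem classical_entry (m : Measure G) [m.IsMulRightInvariant]
    [IsProbabilityMeasure m] (π : UnitaryIrrep G) (g : G) (i j : Fin π.dim) :
    χ.classical (π.entry i j) g = (π.mat g * χ.symbol g π) i j := by
  have hI : ∫ τ, χ.jump (π.entry i j) (fun k => leftDeriv (χ.X k) (π.entry i j)) g τ ∂(χ.ν g)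
      = (π.mat g * Matrix.of fun k l => ∫ τ, χ.symbolJump π g τ k l ∂(χ.ν g)) i j := by
    simp only [χ.jump_entry m, Matrix.mul_apply, Matrix.of_apply]
    rw [integral_finsetSum _ fun l _ => (χ.integrable_symbolJump m π g l j).const_mul _]
    exact Finset.sum_congr rfl fun l _ => integral_const_mul _ _
  rw [classical, expr, hI, symbol, mul_add, mul_add, Matrix.add_apply, Matrix.add_apply]
  simp only [χ.leftDeriv_leftDeriv_entry m]
  simp only [χ.leftDeriv_entry m, Matrix.mul_sum,
    Matrix.sum_apply, Matrix.mul_smul, Matrix.smul_apply, smul_eq_mul]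

theorem star_mat_mul_mat (π : UnitaryIrrep G) (g : G) : star (π.mat g) * π.mat g = 1 :=
  Matrix.mem_unitaryGroup_iff'.1 (π.toHom g).2

theorem symbol_eq_classical (m : Measure G) [m.IsMulRightInvariant]
    [IsProbabilityMeasure m] (π : UnitaryIrrep G) (g : G) (i j : Fin π.dim) :
    χ.symbol g π i j = ∑ k, star (π.mat g k i) * χ.classical (π.entry k j) g := by
  have h : star (π.mat g) * (π.mat g * χ.symbol g π) = χ.symbol g π := by
    rw [← mul_assoc, star_mat_mul_mat, one_mul]
  conv_lhs => rw [← h]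
  rw [Matrix.mul_apply]
  refine Finset.sum_congr rfl fun k _ => ?_
  rw [χ.classical_entry m, Matrix.star_apply]

/-- After the shift the integrand no longer depends on `g`, so measurability of the kernel suffices.
-/
theorem measurable_symbol (π : UnitaryIrrep G) (i j : Fin π.dim) : Measurable fun g => χ.symbol g π i j := by
  have : IsTopologicalGroup G := topologicalGroup_of_lieGroup 𝓘(ℝ, E) ∞
  have : SecondCountableTopology G := ChartedSpace.secondCountable_of_sigmaCompact E G
  have e : ∀ g, ∫ τ, χ.symbolJump π g τ i j ∂(χ.ν g)
      = ∫ τ, χ.shiftedSymbolJump π τ i j ∂(χ.shiftedKernel g) := fun g =>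
    χ.integral_comp_inv_mul (fun τ => χ.shiftedSymbolJump π τ i j) g
  simp only [symbol, Matrix.add_apply, Matrix.sum_apply, Matrix.smul_apply, Matrix.of_apply,
    smul_eq_mul, e]
  refine ((Finset.measurable_sum _ fun k _ => ?_).add (Finset.measurable_sum _ fun k _ =>
    Finset.measurable_sum _ fun l _ => ?_)).add ?_
  · exact (Complex.measurable_ofReal.comp (χ.measurable_b k)).mul_const _
  · exact (Complex.measurable_ofReal.comp (χ.measurable_a k l)).mul_const _
  · exact (StronglyMeasurable.integral_kernel
      (χ.continuous_shiftedSymbolJump π i j).measurable.stronglyMeasurable).measurable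

/-! ### The operator on matrix coefficients -/

theorem coeff_eq_sum (π : UnitaryIrrep G) (ψ φ : Fin π.dim → ℂ) :
    π.coeff ψ φ = ∑ i, ∑ j, (ψ j * star (φ i)) • π.entry i j := by
  ext g
  have h1 : π.coeff ψ φ g = (π.mat g *ᵥ ψ) ⬝ᵥ star φ := rfl
  simp only [h1, ContinuousMap.coe_sum, Finset.sum_apply, ContinuousMap.coe_smul, Pi.smul_apply,
    π.entry_apply, dotProduct, Matrix.mulVec, Finset.sum_mul, Pi.star_apply, smul_eq_mul]
  exact Finset.sum_congr rfl fun i _ => Finset.sum_congr rfl fun j _ => by ring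

theorem matrixCoeffSpan_le_sobolevTwo : matrixCoeffSpan m ≤ sobolevTwo m χ.X := by
  refine Submodule.span_le.2 ?_
  rintro _ ⟨π, ψ, φ, rfl⟩
  rw [toL2, coeff_eq_sum, map_sum]
  refine Submodule.sum_mem _ fun i _ => ?_
  rw [map_sum]
  refine Submodule.sum_mem _ fun j _ => ?_
  rw [map_smul]
  refine Submodule.smul_mem _ _ ⟨_, _, (χ.isSobolevTwo_entry π i j).congr ?_⟩
  exact (ContinuousMap.coeFn_toLp m (𝕜 := ℂ) (π.entry i j)).symm

/-- Since the graph is single-valued, the operator may be evaluated with any representative; here it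
is the smooth entry with its classical derivatives. -/
theorem operator_entry_ae_eq [SecondCountableTopology G]
    (π : UnitaryIrrep G) (i j : Fin π.dim)
    (h : toL2 m (π.entry i j) ∈ (χ.operator m).domain) :
    (χ.operator m ⟨toL2 m (π.entry i j), h⟩ : Lp ℂ 2 m) =ᵐ[m] χ.classical (π.entry i j) := by
  have : IsTopologicalGroup G := topologicalGroup_of_lieGroup 𝓘(ℝ, E) ∞
  have H := χ.isSobolevTwo_entry (m := m) π i j
  have hD : ∀ k, Measurable (leftDeriv (χ.X k) (π.entry i j)) := fun k => by
    rw [χ.leftDeriv_entry m]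
    exact (continuous_mat_mul π _ i j).measurable
  have h1 := χ.mem_graph_of_isSobolevTwo
    (ContinuousMap.coeFn_toLp m (𝕜 := ℂ) (p := 2) (π.entry i j)).symm H
    (π.entry i j).continuous.measurable hD
  rw [← operator_graph] at h1
  have h2 : χ.operator m ⟨toL2 m (π.entry i j), h⟩ = _ := LinearPMap.mem_graph_snd_inj _
    (LinearPMap.mem_graph _ _) h1 rfl
  rw [h2]
  exact MemLp.coeFn_toLp (χ.ae_integrable_jump_and_memLp_expr H
    (π.entry i j).continuous.measurable hD).2

end Characteristics

end CourregeHunt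

end

/-! ### The Courrège–Hunt operator as a pseudo differential operator -/

theorem mainTheorem6
    {E : Type*} [NormedAddCommGroup E] [NormedSpace ℝ E] [FiniteDimensional ℝ E]
    {G : Type*} [TopologicalSpace G] [ChartedSpace E G] [Group G] [LieGroup 𝓘(ℝ, E) ∞ G]
    [T2Space G] [CompactSpace G] [MeasurableSpace G] [BorelSpace G]
    (m : Measure G) [m.IsMulRightInvariant] [IsProbabilityMeasure m]
    {n : ℕ} (χ : CourregeHunt.Characteristics E G n) :
    (χ.operator m).graph = χ.graph m ∧
    (χ.operator m).domain = CourregeHunt.sobolevTwo m χ.X ∧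
    CourregeHunt.IsPseudoDiffOpWithSymbol m (χ.operator m) χ.symbol ∧
    (∀ (g : G) (π : CourregeHunt.UnitaryIrrep G) (k l : Fin π.dim),
      Integrable (fun τ => χ.symbolJump π g τ k l) (χ.ν g)) ∧
    (∀ (g : G) (π : CourregeHunt.UnitaryIrrep G) (i j : Fin π.dim),
      Integrable (χ.jump (π.entry i j)
        (fun k => CourregeHunt.leftDeriv (χ.X k) (π.entry i j)) g) (χ.ν g) ∧
      χ.symbol g π i j =
        ∑ k, star (π.mat g k i) * χ.classical (π.entry k j) g) := by
  have : SecondCountableTopology G := ChartedSpace.secondCountable_of_sigmaCompact E G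
  have : IsTopologicalGroup G := topologicalGroup_of_lieGroup 𝓘(ℝ, E) ∞
  have hdom : CourregeHunt.matrixCoeffSpan m ≤ (χ.operator m).domain :=
    χ.matrixCoeffSpan_le_sobolevTwo.trans_eq χ.operator_domain.symm
  refine ⟨χ.operator_graph, χ.operator_domain, ⟨hdom, fun π i j => ?_, χ.measurable_symbol⟩,
    fun g π k l => χ.integrable_symbolJump m π g k l,
    fun g π i j => ⟨χ.integrable_jump_entry m π g i j, χ.symbol_eq_classical m π g i j⟩⟩
  have h := ae_all_iff.2 fun k => χ.operator_entry_ae_eq (m := m) π k j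
    (hdom (CourregeHunt.entry_mem_matrixCoeffSpan m π k j))
  filter_upwards [h] with g hg
  rw [χ.symbol_eq_classical m]
  exact Finset.sum_congr rfl fun k _ => by rw [hg k]
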